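/- Let $\mathbb{k}$ be an algebraically closed field, $S = \mathbb{k}[x_1,\dots,x_n]$ the standard graded polynomial ring, and $g \ge 4$. Let $I \subseteq S$ be an ideal that is minimally generated by $g$ quadrics (forms of degree $2$) and has one of the following forms: * (i$_a$) $I = (x,y)\cap(z,w)$ or $I = \left((x,y)^2,\, xz+yw\right)$ for linearly independent linear forms $x,y,z,w$; * (i$_b$) $I = (a_1x,\dots,a_{g-1}x,q)$ for linearly independent linear forms $a_1,\dots,a_{g-1}$, a linear form $x$, and a quadric $q \in (a_1,\dots,a_{g-1}) \setminus (x)$; * (ii) $I = (a_1x,\dots,a_{g-1}x,q)$ for linearly independent linear forms $a_1,\dots,a_{g-1}$, a linear form $x$, and a quadric $q$ that is a nonzerodivisor modulo $(a_1x,\dots,a_{g-1}x)$. Write $\beta_{i,j} = \dim_{\mathbb{k}} \operatorname{Tor}_i^S(S/I,\mathbb{k})_j$ for the graded Betti numbers of $S/I$. Then the Betti table of $S/I$, whose entry in column $i$ and row $r$ is $\beta_{i,i+r}$, is one of the following two tables: 1. $\beta_{0,0}=1$, $\beta_{1,2}=g$, $\beta_{2,3}=\binom{g-1}{2}+1$,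 $\beta_{i,i+1}=\binom{g-1}{i}$ for $3\le i\le g-1$, and all other $\beta_{i,j}$ are $0$; 2. $\beta_{0,0}=1$, $\beta_{1,2}=g$, $\beta_{i,i+1}=\binom{g-1}{i}$ for $2\le i\le g-1$, $\beta_{i,i+2}=\binom{g-1}{i-1}$ for $2\le i\le g$, and all other $\beta_{i,j}$ are $0$. The first table occurs exactly when $I$ has form (i$_a$) or (i$_b$), and the second exactly when $I$ has form (ii). -/

import Mathlib

open MvPolynomial

namespace QuadricBetti

/-- `p` is a form of degree `d`, the degree being an integer: every monomial occurring in `p` has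
total degree `d`. So `0` is a form of every degree, and the only form of negative degree. -/
def IsForm {k : Type*} [CommSemiring k] {n : ℕ} (p : MvPolynomial (Fin n) k) (d : ℤ) : Prop :=
  ∀ m : Fin n →₀ ℕ, p.coeff m ≠ 0 → ((m.degree : ℕ) : ℤ) = d

/-- A graded free resolution, by finitely generated graded free modules, of the graded module
`S / I` over the standard graded polynomial ring `S = k[x_1, …, x_n]`:
`⋯ → F_2 → F_1 → F_0 → S / I → 0` with `F_i = ⨁_b S(-deg i b)`, where `b` runs over `rank i`
basis elements. All maps are homogeneous of degree `0`. -/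
structure GradedFreeResolution {k : Type*} [Field k] {n : ℕ}
    (I : Ideal (MvPolynomial (Fin n) k)) where
  /-- the number of basis elements of `F_i` -/
  rank : ℕ → ℕ
  /-- the degrees of the basis elements of `F_i` -/
  deg : (i : ℕ) → Fin (rank i) → ℤ
  /-- the matrix of the differential `F_{i+1} → F_i` -/
  diff : (i : ℕ) → Matrix (Fin (rank i)) (Fin (rank (i + 1))) (MvPolynomial (Fin n) k)
  /-- the augmentation `F_0 → S / I` -/
  aug : (Fin (rank 0) → MvPolynomial (Fin n) k) →ₗ[MvPolynomial (Fin n) k]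
    (MvPolynomial (Fin n) k ⧸ I)
  /-- a basis element of degree `d` goes to a combination with coefficients in the degrees that
  make the differential homogeneous of degree `0` -/
  diff_isForm : ∀ i a b, IsForm (diff i a b) (deg (i + 1) b - deg i a)
  /-- a basis element of `F_0` of degree `d` goes to the degree `d` part of `S / I` -/
  aug_isForm : ∀ b, ∃ p : MvPolynomial (Fin n) k,
    IsForm p (deg 0 b) ∧ Ideal.Quotient.mk I p = aug (Pi.single b 1)
  aug_surjective : Function.Surjective aug
  exact_zero : Function.Exact (diff 0).mulVecLin aug
  exact_succ : ∀ i, Function.Exact (diff (i + 1)).mulVecLin (diff i).mulVecLin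

namespace GradedFreeResolution

variable {k : Type*} [Field k] {n : ℕ} {I : Ideal (MvPolynomial (Fin n) k)}

/-- The degree `j` part of `F_i ⊗_S k`, where `k = S / (x_1, …, x_n)`: as
`F_i ⊗_S k = ⨁_b k(-deg i b)`, its degree `j` part has as basis the basis elements of `F_i` of
degree `j`. -/
abbrev Fiber (F : GradedFreeResolution I) (i : ℕ) (j : ℤ) : Type _ :=
  {b : Fin (F.rank i) // F.deg i b = j} → k

/-- The degree `j` part of the differential `F_{i+1} ⊗_S k → F_i ⊗_S k`. -/
noncomputable def fiberDiff (F : GradedFreeResolution I) (i : ℕ) (j : ℤ) :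
    F.Fiber (i + 1) j →ₗ[k] F.Fiber i j :=
  (((F.diff i).map (fun p => constantCoeff p)).submatrix Subtype.val Subtype.val).mulVecLin

/-- The cycles of the complex `F ⊗_S k` in homological degree `i` and internal degree `j`. -/
noncomputable def cycles (F : GradedFreeResolution I) : (i : ℕ) → (j : ℤ) →
    Submodule k (F.Fiber i j)
  | 0, _ => ⊤
  | i + 1, j => LinearMap.ker (F.fiberDiff i j)

/-- The boundaries of the complex `F ⊗_S k` in homological degree `i` and internal
degree `j`. -/
noncomputable def boundaries (F : GradedFreeResolution I) (i : ℕ) (j : ℤ) :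
    Submodule k (F.Fiber i j) :=
  LinearMap.range (F.fiberDiff i j)

/-- `Tor_i^S(S / I, k)_j`, computed with the resolution `F`: the homology of `F ⊗_S k` in
homological degree `i` and internal degree `j`. -/
abbrev Tor (F : GradedFreeResolution I) (i : ℕ) (j : ℤ) : Type _ :=
  F.cycles i j ⧸ (F.boundaries i j).submoduleOf (F.cycles i j)

end GradedFreeResolution

/-- The Betti table of `S / I` is `T`: the entry `T i r` in column `i` and row `r` is the graded
Betti number `β_{i,i+r}(S / I) = dim_k Tor_i^S(S / I, k)_{i+r}`. Here `Tor` may be computed with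
any graded free resolution of `S / I`, and there is one. -/
def HasBettiTable {k : Type*} [Field k] {n : ℕ} (I : Ideal (MvPolynomial (Fin n) k))
    (T : ℕ → ℤ → ℕ) : Prop :=
  Nonempty (GradedFreeResolution I) ∧
    ∀ (F : GradedFreeResolution I) (i : ℕ) (r : ℤ), Module.finrank k (F.Tor i (i + r)) = T i r

/-- `I` is minimally generated by `g` quadrics: it has a system of `g` generators, all of them
forms of degree `2`, none of which is in the ideal generated by the others. -/
def IsMinimallyGeneratedByQuadrics {k : Type*} [Field k] {n : ℕ}
    (I : Ideal (MvPolynomial (Fin n) k)) (g : ℕ) : Prop :=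
  ∃ f : Fin g → MvPolynomial (Fin n) k,
    (∀ i, (f i).IsHomogeneous 2) ∧ Ideal.span (Set.range f) = I ∧
      ∀ i, f i ∉ Ideal.span (f '' {i}ᶜ)

/-- `I` is `(x, y) ∩ (z, w)` or `((x, y)², xz + yw)` for linearly independent linear forms
`x, y, z, w`. -/
def IsOfFormIa {k : Type*} [Field k] {n : ℕ} (I : Ideal (MvPolynomial (Fin n) k)) : Prop :=
  ∃ x y z w : MvPolynomial (Fin n) k,
    x.IsHomogeneous 1 ∧ y.IsHomogeneous 1 ∧ z.IsHomogeneous 1 ∧ w.IsHomogeneous 1 ∧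
      LinearIndependent k ![x, y, z, w] ∧
      (I = Ideal.span {x, y} ⊓ Ideal.span {z, w} ∨
        I = Ideal.span {x, y} ^ 2 ⊔ Ideal.span {x * z + y * w})

/-- `I` is `(a_1 x, …, a_{g-1} x, q)` for linearly independent linear forms `a_i`, a linear form
`x`, and a quadric `q` which lies in `(a_1, …, a_{g-1})` but not in `(x)`. -/
def IsOfFormIb {k : Type*} [Field k] {n : ℕ} (I : Ideal (MvPolynomial (Fin n) k))
    (g : ℕ) : Prop :=
  ∃ (a : Fin (g - 1) → MvPolynomial (Fin n) k) (x q : MvPolynomial (Fin n) k),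
    (∀ i, (a i).IsHomogeneous 1) ∧ LinearIndependent k a ∧
      x.IsHomogeneous 1 ∧ q.IsHomogeneous 2 ∧
      I = Ideal.span (Set.range fun i => a i * x) ⊔ Ideal.span {q} ∧
      q ∈ Ideal.span (Set.range a) ∧ q ∉ Ideal.span {x}

/-- `I` is `(a_1 x, …, a_{g-1} x, q)` for linearly independent linear forms `a_i`, a linear form
`x`, and a quadric `q` which is a nonzerodivisor modulo `(a_1 x, …, a_{g-1} x)`. -/
def IsOfFormIi {k : Type*} [Field k] {n : ℕ} (I : Ideal (MvPolynomial (Fin n) k))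
    (g : ℕ) : Prop :=
  ∃ (a : Fin (g - 1) → MvPolynomial (Fin n) k) (x q : MvPolynomial (Fin n) k),
    (∀ i, (a i).IsHomogeneous 1) ∧ LinearIndependent k a ∧
      x.IsHomogeneous 1 ∧ q.IsHomogeneous 2 ∧
      I = Ideal.span (Set.range fun i => a i * x) ⊔ Ideal.span {q} ∧
      Ideal.Quotient.mk (Ideal.span (Set.range fun i => a i * x)) q ∈
        nonZeroDivisors (MvPolynomial (Fin n) k ⧸ Ideal.span (Set.range fun i => a i * x))

/-- The Betti table (columns `i`, rows `r`) with a single nonzero row besides row `0`: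
`g, (g-1 choose 2) + 1, (g-1 choose 3), …, (g-1 choose g-2), 1` in columns `1, …, g-1` of
row `1`. -/
def linearTable (g : ℕ) (i : ℕ) (r : ℤ) : ℕ :=
  if r = 0 then (if i = 0 then 1 else 0)
  else if r = 1 then
    (if i = 0 then 0
    else if i = 1 then g
    else if i = 2 then (g - 1).choose 2 + 1
    else (g - 1).choose i)
  else 0

/-- The Betti table (columns `i`, rows `r`) with two nonzero rows besides row `0`:
`g, (g-1 choose 2), …, (g-1 choose g-2), 1` in columns `1, …, g-1` of row `1` and
`g-1, …, (g-1 choose g-3), (g-1 choose g-2), 1` in columns `2, …, g` of row `2`. -/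
def twoRowTable (g : ℕ) (i : ℕ) (r : ℤ) : ℕ :=
  if r = 0 then (if i = 0 then 1 else 0)
  else if r = 1 then
    (if i = 0 then 0
    else if i = 1 then g
    else (g - 1).choose i)
  else if r = 2 then
    (if i ≤ 1 then 0
    else (g - 1).choose (i - 1))
  else 0

end QuadricBetti

/-!
The three forms of ideals have different Betti tables, and each table is read off a minimal graded
free resolution; it then remains to note that the tables differ in the entry of column `2` and
row `2`.

*Independence of the resolution.* The comparison theorem holds in graded form
(`Resolution.exists_chainMap`, `Resolution.exists_homotopy`): preimages of homogeneous elements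
under graded matrices can be replaced by their components of the right degree
(`IsGraded.exists_lift`). So the dimensions of `Tor` may be computed with any resolution
(`GradedFreeResolution.finrank_tor_le`), and for a minimal one they count basis elements.

*Construction of resolutions.* All resolutions are iterated mapping cones. If `q` is a form, then
multiplication by `q` gives an exact sequence `0 → S / (J : q) → S / J → S / (J + (q)) → 0`, so that
resolutions of `S / J` and `S / (J : q)` yield one of `S / (J + (q))` (`Resolution.cone`). It is
minimal if the two given ones are, and the lift of multiplication by `q` has no constant entries,
for which it suffices to compare degrees (`HasMinimalResolution.cone`).

*Colon ideals.* Ideals generated by linear forms are prime and contain only the obvious linear forms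
(`exists_algHom_ker_eq_span`). Hence linearly independent linear forms `a_1, …, a_m` can be added
one at a time with colon ideals `(a_1, …, a_i)`, both to build `(a_1, …, a_m)` and to build
`(a_1 x, …, a_m x)`. For the remaining quadric `q` the colon ideal of `J = (a_1 x, …, a_m x)` is
`(x)` if `q ∈ (a_1, …, a_m) \ (x)`, and `J` if `q` is a nonzerodivisor modulo `J`. The ideals
`(x, y) ∩ (z, w) = (x z, x w, y z, y w)` and `(x², x y, y², x z + y w)` arise from `(x z, x w)` and
`(x², x y)` by adding two quadrics, with colon ideals generated by one and two linear forms. As they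
have four generators, `g = 4` for them.
-/

namespace QuadricBetti

open Matrix

/-! ### Forms and graded matrices -/

section Forms

variable {k : Type*} [Field k] {n : ℕ}

lemma isForm_of_isHomogeneous {p : MvPolynomial (Fin n) k} {d : ℕ} (hp : p.IsHomogeneous d) :
    IsForm p d := by
  intro m hm
  have := hp hm
  rw [Finsupp.degree_eq_weight_one]
  exact_mod_cast this

lemma IsForm.zero (d : ℤ) : IsForm (0 : MvPolynomial (Fin n) k) d := fun m hm => by simp at hm

lemma IsForm.one : IsForm (1 : MvPolynomial (Fin n) k) 0 :=
  mod_cast isForm_of_isHomogeneous (isHomogeneous_one (Fin n) k)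

lemma IsForm.add {p q : MvPolynomial (Fin n) k} {d : ℤ} (hp : IsForm p d) (hq : IsForm q d) :
    IsForm (p + q) d := by
  intro m hm
  by_cases h : p.coeff m = 0
  · exact hq m fun h' => hm (by simp [h, h'])
  · exact hp m h

lemma IsForm.neg {p : MvPolynomial (Fin n) k} {d : ℤ} (hp : IsForm p d) : IsForm (-p) d :=
  fun m hm => hp m fun h => hm (by simp [h])

lemma IsForm.sub {p q : MvPolynomial (Fin n) k} {d : ℤ} (hp : IsForm p d) (hq : IsForm q d) :
    IsForm (p - q) d := sub_eq_add_neg p q ▸ hp.add hq.neg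

lemma IsForm.sum {ι : Type*} {s : Finset ι} {f : ι → MvPolynomial (Fin n) k} {d : ℤ}
    (h : ∀ i ∈ s, IsForm (f i) d) : IsForm (∑ i ∈ s, f i) d :=
  Finset.sum_induction f (fun p => IsForm p d) (fun _ _ => IsForm.add) (IsForm.zero d) h

lemma IsForm.mul {p q : MvPolynomial (Fin n) k} {d e : ℤ} (hp : IsForm p d) (hq : IsForm q e) :
    IsForm (p * q) (d + e) := by
  classical
  intro m hm
  rw [coeff_mul] at hm
  obtain ⟨⟨x, y⟩, hxy, h⟩ := Finset.exists_ne_zero_of_sum_ne_zero hm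
  rw [Finset.HasAntidiagonal.mem_antidiagonal] at hxy
  rw [← hp x (left_ne_zero_of_mul h), ← hq y (right_ne_zero_of_mul h), ← hxy]
  simp

/-- A form of nonzero degree has no constant term. -/
lemma IsForm.constantCoeff_eq_zero {p : MvPolynomial (Fin n) k} {d : ℤ} (hp : IsForm p d)
    (hd : d ≠ 0) : constantCoeff p = 0 := by
  by_contra h
  exact hd (by simpa using (hp 0 h).symm)

/-- The component of degree `d` of a polynomial, for an integer `d`; it is `0` when `d < 0`. -/
noncomputable def formComponent (d : ℤ) : MvPolynomial (Fin n) k →ₗ[k] MvPolynomial (Fin n) k :=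
  if 0 ≤ d then homogeneousComponent d.toNat else 0

lemma coeff_formComponent (d : ℤ) (p : MvPolynomial (Fin n) k) (m : Fin n →₀ ℕ) :
    coeff m (formComponent d p) = if ((m.degree : ℕ) : ℤ) = d then coeff m p else 0 := by
  unfold formComponent
  split_ifs with h0 h1 h1
  · rw [coeff_homogeneousComponent, if_pos (by omega)]
  · rw [coeff_homogeneousComponent, if_neg (by omega)]
  · omega
  · simp

lemma isForm_formComponent (d : ℤ) (p : MvPolynomial (Fin n) k) : IsForm (formComponent d p) d := by
  intro m hm
  rw [coeff_formComponent] at hm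
  by_contra h
  simp [h] at hm

lemma IsForm.formComponent_eq {p : MvPolynomial (Fin n) k} {d : ℤ} (hp : IsForm p d) :
    formComponent d p = p := by
  ext m
  rw [coeff_formComponent]
  split_ifs with h
  · rfl
  · by_contra h'
    exact h (hp m (Ne.symm h'))

lemma IsForm.formComponent_mul {p : MvPolynomial (Fin n) k} {e : ℤ} (hp : IsForm p e) (d : ℤ)
    (q : MvPolynomial (Fin n) k) : formComponent d (p * q) = p * formComponent (d - e) q := by
  classical
  ext m
  rw [coeff_formComponent, coeff_mul, coeff_mul]
  simp only [coeff_formComponent]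
  rw [show ∀ (c : Prop) [Decidable c] (s : Finset ((Fin n →₀ ℕ) × (Fin n →₀ ℕ)))
    (f : (Fin n →₀ ℕ) × (Fin n →₀ ℕ) → k), (if c then ∑ x ∈ s, f x else 0) =
      ∑ x ∈ s, if c then f x else 0 from fun c _ s f => by split_ifs <;> simp]
  refine Finset.sum_congr rfl fun x hx => ?_
  rw [Finset.HasAntidiagonal.mem_antidiagonal] at hx
  by_cases h : coeff x.1 p = 0
  · simp [h]
  · have h1 := hp _ h
    have h2 : (m.degree : ℤ) = x.1.degree + x.2.degree := by rw [← hx]; simp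
    by_cases h3 : (m.degree : ℤ) = d
    · rw [if_pos h3, if_pos (by omega)]
    · rw [if_neg h3, if_neg (by omega), mul_zero]

/-- The matrix `M` describes a homomorphism of degree `0` between the graded free modules whose
basis elements have the degrees `dB` (columns) and `dA` (rows). -/
def IsGraded {A B : Type*} (M : Matrix A B (MvPolynomial (Fin n) k)) (dA : A → ℤ) (dB : B → ℤ) :
    Prop :=
  ∀ a b, IsForm (M a b) (dB b - dA a)

lemma IsGraded.mul {A B C : Type*} [Fintype B] {M : Matrix A B (MvPolynomial (Fin n) k)}
    {N : Matrix B C (MvPolynomial (Fin n) k)} {dA : A → ℤ} {dB : B → ℤ} {dC : C → ℤ}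
    (hM : IsGraded M dA dB) (hN : IsGraded N dB dC) : IsGraded (M * N) dA dC := by
  intro a c
  rw [Matrix.mul_apply]
  refine IsForm.sum fun b _ => ?_
  have := (hM a b).mul (hN b c)
  rwa [show dB b - dA a + (dC c - dB b) = dC c - dA a by ring] at this

lemma IsGraded.sub {A B : Type*} {M N : Matrix A B (MvPolynomial (Fin n) k)}
    {dA : A → ℤ} {dB : B → ℤ} (hM : IsGraded M dA dB) (hN : IsGraded N dA dB) :
    IsGraded (M - N) dA dB := fun a b => (hM a b).sub (hN a b)

lemma isGraded_one {A : Type*} [DecidableEq A] (dA : A → ℤ) :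
    IsGraded (1 : Matrix A A (MvPolynomial (Fin n) k)) dA dA := by
  intro a b
  rw [Matrix.one_apply]
  split_ifs with h
  · subst h
    simpa using IsForm.one
  · exact IsForm.zero _

lemma IsGraded.add_const {A B : Type*} {M : Matrix A B (MvPolynomial (Fin n) k)}
    {dA : A → ℤ} {dB : B → ℤ} (hM : IsGraded M dA dB) (e : ℤ) :
    IsGraded M (fun a => dA a + e) (fun b => dB b + e) := by
  intro a b
  simpa using hM a b

/-- If all columns of a graded matrix `P` lie in the image of a graded matrix `M`, then `P` factors
through `M` by a graded matrix: the components of the right degrees of any preimages form one. -/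
lemma IsGraded.exists_lift {A B C : Type*} [Fintype B] {M : Matrix A B (MvPolynomial (Fin n) k)}
    {P : Matrix A C (MvPolynomial (Fin n) k)} {dA : A → ℤ} {dB : B → ℤ} {dC : C → ℤ}
    (hM : IsGraded M dA dB) (hP : IsGraded P dA dC)
    (h : ∀ c, ∃ w, M *ᵥ w = fun a => P a c) :
    ∃ Q : Matrix B C (MvPolynomial (Fin n) k), IsGraded Q dB dC ∧ M * Q = P := by
  choose w hw using h
  refine ⟨.of fun b c => formComponent (dC c - dB b) (w c b),
    fun b c => isForm_formComponent _ _, ?_⟩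
  ext1 a c
  rw [← (hP a c).formComponent_eq, ← congrFun (hw c) a, Matrix.mul_apply]
  simp only [Matrix.mulVec, dotProduct, map_sum, Matrix.of_apply]
  refine Finset.sum_congr rfl fun b _ => ?_
  rw [(hM a b).formComponent_mul]
  rw [show dC c - dA a - (dB b - dA a) = dC c - dB b by ring]

/-- An ideal generated by forms contains the components of its elements. -/
lemma formComponent_mem_span {s : Set (MvPolynomial (Fin n) k)} (hs : ∀ p ∈ s, ∃ d, IsForm p d)
    {p : MvPolynomial (Fin n) k} (hp : p ∈ Ideal.span s) (d : ℤ) :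
    formComponent d p ∈ Ideal.span s := by
  induction hp using Submodule.span_induction generalizing d with
  | mem p hp =>
    obtain ⟨e, he⟩ := hs p hp
    rw [← mul_one p, he.formComponent_mul]
    exact Ideal.mul_mem_right _ _ (Ideal.subset_span hp)
  | zero => simp
  | add p q _ _ h1 h2 => rw [map_add]; exact add_mem (h1 d) (h2 d)
  | smul a p _ h =>
    induction a using MvPolynomial.induction_on' generalizing d with
    | monomial u c =>
      rw [smul_eq_mul, (isForm_of_isHomogeneous (isHomogeneous_monomial c rfl)).formComponent_mul]
      exact Ideal.mul_mem_left _ _ (h _)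
    | add a b ha hb => rw [add_smul, map_add]; exact add_mem (ha d) (hb d)

end Forms

/-! ### Resolutions with arbitrary index types -/

/-- A graded free resolution of `S / I` by finitely generated modules, where the basis elements of
`F_i` are indexed by an arbitrary finite type. The augmentation `F_0 → S / I` is given by a row
`ε` of representatives in `S`, and surjectivity and exactness at `F_0` are stated modulo `I`. The
ideal `I` is required to contain the components of its elements. -/
structure Resolution {k : Type*} [Field k] {n : ℕ} (I : Ideal (MvPolynomial (Fin n) k)) where
  /-- the type of basis elements of `F_i` -/
  ι : ℕ → Type
  fintype : ∀ i, Fintype (ι i)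
  /-- the degrees of the basis elements -/
  deg : ∀ i, ι i → ℤ
  /-- the matrix of the differential `F_{i+1} → F_i` -/
  d : ∀ i, Matrix (ι i) (ι (i + 1)) (MvPolynomial (Fin n) k)
  /-- representatives of the images of the basis elements of `F_0` in `S / I` -/
  ε : ι 0 → MvPolynomial (Fin n) k
  formComponent_mem : ∀ p ∈ I, ∀ d : ℤ, formComponent d p ∈ I
  isForm_ε : ∀ a, IsForm (ε a) (deg 0 a)
  isGraded_d : ∀ i, IsGraded (d i) (deg i) (deg (i + 1))
  surjective : ∀ f, ∃ v, f - ε ⬝ᵥ v ∈ I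
  exact_zero : ∀ v, ε ⬝ᵥ v ∈ I ↔ ∃ w, d 0 *ᵥ w = v
  exact_succ : ∀ i v, d i *ᵥ v = 0 ↔ ∃ w, d (i + 1) *ᵥ w = v

namespace Resolution

variable {k : Type*} [Field k] {n : ℕ} {I L : Ideal (MvPolynomial (Fin n) k)}

attribute [instance] Resolution.fintype

lemma d_mul_d (F : Resolution I) (i : ℕ) : F.d i * F.d (i + 1) = 0 := by
  classical
  refine Matrix.ext_of_mulVec_single fun c => ?_
  rw [← Matrix.mulVec_mulVec, (F.exact_succ i _).2 ⟨_, rfl⟩, Matrix.zero_mulVec]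

lemma d_mul_d_assoc (F : Resolution I) (i : ℕ) {A : Type*}
    (M : Matrix A (F.ι i) (MvPolynomial (Fin n) k)) : M * F.d i * F.d (i + 1) = 0 := by
  rw [Matrix.mul_assoc, d_mul_d, Matrix.mul_zero]

lemma ε_vecMul_d_mem (F : Resolution I) (b : F.ι 1) : (F.ε ᵥ* F.d 0) b ∈ I := by
  classical
  have := (F.exact_zero (F.d 0 *ᵥ Pi.single b 1)).2 ⟨_, rfl⟩
  rwa [Matrix.dotProduct_mulVec, dotProduct_single_one] at this

/-- Dependent choice along a sequence of types. -/
lemma exists_seq {α : ℕ → Type*} (P : ∀ i, α i → Prop) (R : ∀ i, α i → α (i + 1) → Prop)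
    (a : α 0) (ha : P 0 a) (h : ∀ i x, P i x → ∃ y, P (i + 1) y ∧ R i x y) :
    ∃ f : ∀ i, α i, f 0 = a ∧ (∀ i, P i (f i)) ∧ ∀ i, R i (f i) (f (i + 1)) := by
  choose y hy using h
  let f : ∀ i, {x : α i // P i x} := fun i =>
    Nat.rec ⟨a, ha⟩ (fun i x => ⟨y i x.1 x.2, (hy i x.1 x.2).1⟩) i
  exact ⟨fun i => (f i).1, rfl, fun i => (f i).2, fun i => (hy i _ (f i).2).2⟩

/-- Multiplication by a form `q` of degree `e`, as a map `S / I → S / L` of degree `e`, lifts to a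
chain map of degree `e` between resolutions. -/
lemma exists_chainMap (F : Resolution I) (G : Resolution L) {q : MvPolynomial (Fin n) k} {e : ℤ}
    (hq : IsForm q e) (h : ∀ f ∈ I, f * q ∈ L) :
    ∃ φ : ∀ i, Matrix (G.ι i) (F.ι i) (MvPolynomial (Fin n) k),
      (∀ i, IsGraded (φ i) (G.deg i) (fun b => F.deg i b + e)) ∧
      (∀ b, (G.ε ᵥ* φ 0) b - F.ε b * q ∈ L) ∧
      ∀ i, G.d i * φ (i + 1) = φ i * F.d i := by
  have h0 : ∃ φ : Matrix (G.ι 0) (F.ι 0) (MvPolynomial (Fin n) k),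
      IsGraded φ (G.deg 0) (fun b => F.deg 0 b + e) ∧
      ∀ b, (G.ε ᵥ* φ) b - F.ε b * q ∈ L := by
    choose v hv using fun b => G.surjective (F.ε b * q)
    refine ⟨.of fun a b => formComponent (F.deg 0 b + e - G.deg 0 a) (v b a),
      fun a b => isForm_formComponent _ _, fun b => ?_⟩
    have h1 := G.formComponent_mem _ (hv b) (F.deg 0 b + e)
    rw [map_sub, ((F.isForm_ε b).mul hq).formComponent_eq] at h1
    rw [← neg_mem_iff, neg_sub]
    convert h1 using 2
    simp only [Matrix.vecMul, dotProduct, map_sum, Matrix.of_apply]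
    exact Finset.sum_congr rfl fun a _ => ((G.isForm_ε a).formComponent_mul _ _).symm
  obtain ⟨φ₀, hφ₀, hε⟩ := h0
  have hbase : ∀ c, ∃ w, G.d 0 *ᵥ w = fun a => (φ₀ * F.d 0) a c := by
    refine fun c => (G.exact_zero _).1 ?_
    have h1 : (G.ε ⬝ᵥ fun a => (φ₀ * F.d 0) a c) = ((G.ε ᵥ* φ₀) ᵥ* F.d 0) c := by
      rw [Matrix.vecMul_vecMul]
      rfl
    have h2 : ((G.ε ᵥ* φ₀) ᵥ* F.d 0) c = (∑ b, ((G.ε ᵥ* φ₀) b - F.ε b * q) * F.d 0 b c) +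
        (F.ε ᵥ* F.d 0) c * q := by
      change ∑ b, (G.ε ᵥ* φ₀) b * F.d 0 b c = _ + (∑ b, F.ε b * F.d 0 b c) * q
      rw [Finset.sum_mul, ← Finset.sum_add_distrib]
      exact Finset.sum_congr rfl fun b _ => by ring
    rw [h1, h2]
    exact add_mem (sum_mem fun b _ => Ideal.mul_mem_right _ _ (hε b)) (h _ (F.ε_vecMul_d_mem c))
  have hstep : ∀ i (φ : Matrix (G.ι i) (F.ι i) (MvPolynomial (Fin n) k)),
      (IsGraded φ (G.deg i) (fun b => F.deg i b + e) ∧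
        ∀ c, ∃ w, G.d i *ᵥ w = fun a => (φ * F.d i) a c) →
      ∃ φ' : Matrix (G.ι (i + 1)) (F.ι (i + 1)) (MvPolynomial (Fin n) k),
        (IsGraded φ' (G.deg (i + 1)) (fun b => F.deg (i + 1) b + e) ∧
          ∀ c, ∃ w, G.d (i + 1) *ᵥ w = fun a => (φ' * F.d (i + 1)) a c) ∧
        G.d i * φ' = φ * F.d i := by
    rintro i φ ⟨hφ, hc⟩
    obtain ⟨φ', hφ', he⟩ := (G.isGraded_d i).exists_lift (hφ.mul ((F.isGraded_d i).add_const e)) hc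
    refine ⟨φ', ⟨hφ', fun c => (G.exact_succ i _).1 ?_⟩, he⟩
    have : G.d i * (φ' * F.d (i + 1)) = 0 := by
      rw [← Matrix.mul_assoc, he, d_mul_d_assoc]
    funext a
    exact congrFun (congrFun this a) c
  obtain ⟨φ, rfl, hP, hR⟩ := exists_seq _ _ φ₀ ⟨hφ₀, hbase⟩ hstep
  exact ⟨φ, fun i => (hP i).1, hε, hR⟩

/-- A chain map of degree `0` between resolutions that lifts the zero map `S / I → S / L` is
null-homotopic. -/
lemma exists_homotopy (F : Resolution I) (G : Resolution L)
    (φ : ∀ i, Matrix (G.ι i) (F.ι i) (MvPolynomial (Fin n) k))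
    (hφ : ∀ i, IsGraded (φ i) (G.deg i) (F.deg i)) (hε : ∀ b, (G.ε ᵥ* φ 0) b ∈ L)
    (hd : ∀ i, G.d i * φ (i + 1) = φ i * F.d i) :
    ∃ s : ∀ i, Matrix (G.ι (i + 1)) (F.ι i) (MvPolynomial (Fin n) k),
      (∀ i, IsGraded (s i) (G.deg (i + 1)) (F.deg i)) ∧ φ 0 = G.d 0 * s 0 ∧
      ∀ i, φ (i + 1) = G.d (i + 1) * s (i + 1) + s i * F.d i := by
  obtain ⟨s₀, hs₀, he₀⟩ := (G.isGraded_d 0).exists_lift (hφ 0)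
    (fun c => (G.exact_zero _).1 (hε c))
  have hstep : ∀ i (s : Matrix (G.ι (i + 1)) (F.ι i) (MvPolynomial (Fin n) k)),
      (IsGraded s (G.deg (i + 1)) (F.deg i) ∧ G.d i * (φ (i + 1) - s * F.d i) = 0) →
      ∃ s' : Matrix (G.ι (i + 1 + 1)) (F.ι (i + 1)) (MvPolynomial (Fin n) k),
        (IsGraded s' (G.deg (i + 1 + 1)) (F.deg (i + 1)) ∧
          G.d (i + 1) * (φ (i + 1 + 1) - s' * F.d (i + 1)) = 0) ∧
        G.d (i + 1) * s' = φ (i + 1) - s * F.d i := by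
    rintro i s ⟨hs, h0⟩
    obtain ⟨s', hs', he⟩ := (G.isGraded_d (i + 1)).exists_lift
      ((hφ (i + 1)).sub (hs.mul (F.isGraded_d i)))
      (fun c => (G.exact_succ i _).1 (funext fun a => congrFun (congrFun h0 a) c))
    refine ⟨s', ⟨hs', ?_⟩, he⟩
    rw [Matrix.mul_sub, ← Matrix.mul_assoc, he, hd, Matrix.sub_mul, d_mul_d_assoc, sub_zero,
      sub_self]
  obtain ⟨s, rfl, hP, hR⟩ := exists_seq _ _ s₀
    ⟨hs₀, by rw [Matrix.mul_sub, ← Matrix.mul_assoc, he₀, hd, sub_self]⟩ hstep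
  exact ⟨s, fun i => (hP i).1, he₀.symm, fun i => by rw [hR, sub_add_cancel]⟩

end Resolution

/-! ### Independence of the resolution -/

section Fiber

variable {k : Type*} [Field k] {n : ℕ}

/-- The degree `j` part of `M ⊗_S k`, for a graded matrix `M`. -/
noncomputable def fiberMatrix {A B : Type*} (dA : A → ℤ) (dB : B → ℤ) (j : ℤ)
    (M : Matrix A B (MvPolynomial (Fin n) k)) : Matrix {a // dA a = j} {b // dB b = j} k :=
  (M.map (fun p => constantCoeff p)).submatrix Subtype.val Subtype.val

lemma fiberMatrix_mul {A B C : Type*} [Fintype B] {M : Matrix A B (MvPolynomial (Fin n) k)}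
    {N : Matrix B C (MvPolynomial (Fin n) k)} {dA : A → ℤ} {dB : B → ℤ} {dC : C → ℤ}
    (hN : IsGraded N dB dC) (j : ℤ) :
    fiberMatrix dA dC j (M * N) = fiberMatrix dA dB j M * fiberMatrix dB dC j N := by
  classical
  ext ⟨a, ha⟩ ⟨c, hc⟩
  simp only [fiberMatrix, Matrix.submatrix_apply, Matrix.map_apply, Matrix.mul_apply, map_sum,
    map_mul]
  -- summands with `dB b ≠ j` vanish, as there `N b c` is a form of nonzero degree
  rw [← Finset.sum_subset (Finset.subset_univ ({b | dB b = j} : Finset B))]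
  · exact Finset.sum_subtype _ (by simp) _
  · intro b _ hb
    rw [(hN b c).constantCoeff_eq_zero (by simp at hb; omega), mul_zero]

lemma fiberMatrix_add {A B : Type*} (dA : A → ℤ) (dB : B → ℤ) (j : ℤ)
    (M N : Matrix A B (MvPolynomial (Fin n) k)) :
    fiberMatrix dA dB j (M + N) = fiberMatrix dA dB j M + fiberMatrix dA dB j N := by
  ext; simp [fiberMatrix]

lemma fiberMatrix_one {A : Type*} [DecidableEq A] (dA : A → ℤ) (j : ℤ) :
    fiberMatrix dA dA j (1 : Matrix A A (MvPolynomial (Fin n) k)) = 1 := by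
  ext a b
  simp only [fiberMatrix, Matrix.submatrix_apply, Matrix.map_apply, Matrix.one_apply,
    Subtype.ext_iff]
  split_ifs <;> simp

end Fiber

/-- Any two resolutions of `S / I` admit comparison maps `φ : F → G` and `ψ : G → F` of degree `0`
such that `ψ φ` is homotopic to the identity. -/
lemma Resolution.exists_comparison {k : Type*} [Field k] {n : ℕ}
    {I : Ideal (MvPolynomial (Fin n) k)} (F G : Resolution I) [∀ i, DecidableEq (F.ι i)] :
    ∃ (φ : ∀ i, Matrix (G.ι i) (F.ι i) (MvPolynomial (Fin n) k))
      (ψ : ∀ i, Matrix (F.ι i) (G.ι i) (MvPolynomial (Fin n) k))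
      (s : ∀ i, Matrix (F.ι (i + 1)) (F.ι i) (MvPolynomial (Fin n) k)),
      (∀ i, IsGraded (φ i) (G.deg i) (F.deg i)) ∧ (∀ i, IsGraded (ψ i) (F.deg i) (G.deg i)) ∧
      (∀ i, IsGraded (s i) (F.deg (i + 1)) (F.deg i)) ∧
      (∀ i, G.d i * φ (i + 1) = φ i * F.d i) ∧
      (∀ i, F.d i * ψ (i + 1) = ψ i * G.d i) ∧
      ψ 0 * φ 0 = 1 + F.d 0 * s 0 ∧
      ∀ i, ψ (i + 1) * φ (i + 1) = 1 + (F.d (i + 1) * s (i + 1) + s i * F.d i) := by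
  have h1 : ∀ f ∈ I, f * 1 ∈ I := by simp
  obtain ⟨φ, hφ, hφε, hφd⟩ := F.exists_chainMap G IsForm.one h1
  obtain ⟨ψ, hψ, hψε, hψd⟩ := G.exists_chainMap F IsForm.one h1
  simp only [add_zero] at hφ hψ
  have hε : ∀ b, (F.ε ᵥ* (ψ 0 * φ 0 - 1)) b ∈ I := by
    intro b
    have h2 : (F.ε ᵥ* (ψ 0 * φ 0 - 1)) b = ∑ c, ((F.ε ᵥ* ψ 0) c - G.ε c * 1) * φ 0 c b +
        ((G.ε ᵥ* φ 0) b - F.ε b * 1) := by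
      rw [Matrix.vecMul_sub, ← Matrix.vecMul_vecMul, Matrix.vecMul_one]
      change ∑ c, (F.ε ᵥ* ψ 0) c * φ 0 c b - F.ε b = _ + (∑ c, G.ε c * φ 0 c b - F.ε b * 1)
      rw [← add_sub_assoc, ← Finset.sum_add_distrib, mul_one]
      congr 1
      exact Finset.sum_congr rfl fun c _ => by ring
    rw [h2]
    exact add_mem (sum_mem fun c _ => Ideal.mul_mem_right _ _ (hψε c)) (hφε b)
  have hd : ∀ i, F.d i * (ψ (i + 1) * φ (i + 1) - 1) = (ψ i * φ i - 1) * F.d i := by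
    intro i
    rw [Matrix.mul_sub, ← Matrix.mul_assoc, hψd, Matrix.mul_assoc, hφd, Matrix.sub_mul,
      Matrix.mul_assoc, Matrix.mul_one, Matrix.one_mul]
  obtain ⟨s, hs, hs0, hsd⟩ := F.exists_homotopy F (fun i => ψ i * φ i - 1)
    (fun i => ((hψ i).mul (hφ i)).sub (isGraded_one _)) hε hd
  exact ⟨φ, ψ, s, hφ, hψ, hs, hφd, hψd, sub_eq_iff_eq_add'.1 hs0,
      fun i => sub_eq_iff_eq_add'.1 (hsd i)⟩

namespace GradedFreeResolution

variable {k : Type*} [Field k] {n : ℕ} {I : Ideal (MvPolynomial (Fin n) k)}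

lemma fiberDiff_eq (F : GradedFreeResolution I) (i : ℕ) (j : ℤ) :
    F.fiberDiff i j = (fiberMatrix (F.deg i) (F.deg (i + 1)) j (F.diff i)).mulVecLin := rfl

/-- The images of the basis elements of `F_0` in `S / I` have homogeneous representatives, and these
determine the augmentation. -/
lemma exists_row_aug (F : GradedFreeResolution I) :
    ∃ ε : Fin (F.rank 0) → MvPolynomial (Fin n) k, (∀ a, IsForm (ε a) (F.deg 0 a)) ∧
      ∀ v, F.aug v = Ideal.Quotient.mk I (ε ⬝ᵥ v) := by
  choose ε h1 hε using F.aug_isForm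
  refine ⟨ε, h1, fun v => ?_⟩
  conv_lhs => rw [← (Pi.basisFun (MvPolynomial (Fin n) k) (Fin (F.rank 0))).sum_repr v]
  rw [map_sum]
  simp only [map_smul, Pi.basisFun_repr, Pi.basisFun_apply, ← hε, dotProduct, map_sum, map_mul]
  exact Finset.sum_congr rfl fun b _ => by rw [mul_comm]; rfl

/-- A graded free resolution as a `Resolution`. -/
noncomputable def toResolution (F : GradedFreeResolution I)
    (hI : ∀ p ∈ I, ∀ d : ℤ, formComponent d p ∈ I) : Resolution I where
  ι i := Fin (F.rank i)
  fintype _ := inferInstance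
  deg := F.deg
  d := F.diff
  ε := F.exists_row_aug.choose
  formComponent_mem := hI
  isForm_ε := F.exists_row_aug.choose_spec.1
  isGraded_d := F.diff_isForm
  surjective f := by
    obtain ⟨v, hv⟩ := F.aug_surjective (Ideal.Quotient.mk I f)
    exact ⟨v, Ideal.Quotient.eq.1 (by rw [← hv, F.exists_row_aug.choose_spec.2])⟩
  exact_zero v := by
    rw [← Ideal.Quotient.eq_zero_iff_mem, ← F.exists_row_aug.choose_spec.2]
    exact F.exact_zero v
  exact_succ i v := F.exact_succ i v

/-- The comparison map `F → G` is injective on `Tor`, as it has a left inverse up to homotopy. With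
the roles of `F` and `G` exchanged, this shows that `Tor` does not depend on the resolution. -/
lemma finrank_tor_le (F G : GradedFreeResolution I)
    (hI : ∀ p ∈ I, ∀ d : ℤ, formComponent d p ∈ I) (i : ℕ) (j : ℤ) :
    Module.finrank k (F.Tor i j) ≤ Module.finrank k (G.Tor i j) := by
  have hcomp : ∃ (φ : ∀ i, Matrix (Fin (G.rank i)) (Fin (F.rank i)) (MvPolynomial (Fin n) k))
      (ψ : ∀ i, Matrix (Fin (F.rank i)) (Fin (G.rank i)) (MvPolynomial (Fin n) k))
      (s : ∀ i, Matrix (Fin (F.rank (i + 1))) (Fin (F.rank i)) (MvPolynomial (Fin n) k)),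
      (∀ i, IsGraded (φ i) (G.deg i) (F.deg i)) ∧ (∀ i, IsGraded (ψ i) (F.deg i) (G.deg i)) ∧
      (∀ i, IsGraded (s i) (F.deg (i + 1)) (F.deg i)) ∧
      (∀ i, G.diff i * φ (i + 1) = φ i * F.diff i) ∧
      (∀ i, F.diff i * ψ (i + 1) = ψ i * G.diff i) ∧
      ψ 0 * φ 0 = 1 + F.diff 0 * s 0 ∧
      ∀ i, ψ (i + 1) * φ (i + 1) = 1 + (F.diff (i + 1) * s (i + 1) + s i * F.diff i) :=
    @Resolution.exists_comparison _ _ _ _ (F.toResolution hI) (G.toResolution hI)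
      fun i => inferInstanceAs (DecidableEq (Fin (F.rank i)))
  obtain ⟨φ, ψ, s, hφ, hψ, hs, hφd, hψd, h0, hsucc⟩ := hcomp
  let Φ : ∀ i, F.Fiber i j →ₗ[k] G.Fiber i j := fun i => (fiberMatrix _ _ j (φ i)).mulVecLin
  let Ψ : ∀ i, G.Fiber i j →ₗ[k] F.Fiber i j := fun i => (fiberMatrix _ _ j (ψ i)).mulVecLin
  let σ : ∀ i, F.Fiber i j →ₗ[k] F.Fiber (i + 1) j := fun i =>
    (fiberMatrix _ _ j (s i)).mulVecLin
  have hΦ : ∀ i v, G.fiberDiff i j (Φ (i + 1) v) = Φ i (F.fiberDiff i j v) := by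
    intro i v
    have := congrArg (fiberMatrix (G.deg i) (F.deg (i + 1)) j) (hφd i)
    rw [fiberMatrix_mul (hφ (i + 1)), fiberMatrix_mul (F.diff_isForm i)] at this
    simp only [Φ, fiberDiff_eq, Matrix.mulVecLin_apply, Matrix.mulVec_mulVec, this]
  have hΨ : ∀ i v, F.fiberDiff i j (Ψ (i + 1) v) = Ψ i (G.fiberDiff i j v) := by
    intro i v
    have := congrArg (fiberMatrix (F.deg i) (G.deg (i + 1)) j) (hψd i)
    rw [fiberMatrix_mul (hψ (i + 1)), fiberMatrix_mul (G.diff_isForm i)] at this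
    simp only [Ψ, fiberDiff_eq, Matrix.mulVecLin_apply, Matrix.mulVec_mulVec, this]
  have hσ0 : ∀ v, Ψ 0 (Φ 0 v) = v + F.fiberDiff 0 j (σ 0 v) := by
    intro v
    have := congrArg (fiberMatrix (F.deg 0) (F.deg 0) j) h0
    rw [fiberMatrix_add, fiberMatrix_one, fiberMatrix_mul (hφ 0), fiberMatrix_mul (hs 0)] at this
    simp only [Φ, Ψ, σ, fiberDiff_eq, Matrix.mulVecLin_apply, Matrix.mulVec_mulVec, this,
      Matrix.add_mulVec, Matrix.one_mulVec]
  have hσ : ∀ i v, Ψ (i + 1) (Φ (i + 1) v) =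
      v + (F.fiberDiff (i + 1) j (σ (i + 1) v) + σ i (F.fiberDiff i j v)) := by
    intro i v
    have := congrArg (fiberMatrix (F.deg (i + 1)) (F.deg (i + 1)) j) (hsucc i)
    rw [fiberMatrix_add, fiberMatrix_add, fiberMatrix_one, fiberMatrix_mul (hφ (i + 1)),
      fiberMatrix_mul (hs (i + 1)), fiberMatrix_mul (F.diff_isForm i)] at this
    simp only [Φ, Ψ, σ, fiberDiff_eq, Matrix.mulVecLin_apply, Matrix.mulVec_mulVec, this,
      Matrix.add_mulVec, Matrix.one_mulVec]
  have hcyc : ∀ v ∈ F.cycles i j, Φ i v ∈ G.cycles i j := by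
    intro v hv
    cases i with
    | zero => exact Submodule.mem_top
    | succ i =>
      have hv' : F.fiberDiff i j v = 0 := hv
      change G.fiberDiff i j (Φ (i + 1) v) = 0
      rw [hΦ, hv', map_zero]
  have hbd : ∀ v ∈ F.boundaries i j, Φ i v ∈ G.boundaries i j := by
    rintro _ ⟨w, rfl⟩
    exact ⟨Φ (i + 1) w, hΦ i w⟩
  have hinj : ∀ v ∈ F.cycles i j, Φ i v ∈ G.boundaries i j → v ∈ F.boundaries i j := by
    rintro v hv ⟨w, hw⟩
    cases i with
    | zero =>
      refine ⟨Ψ 1 w - σ 0 v, ?_⟩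
      rw [map_sub, hΨ, hw, hσ0, add_sub_cancel_right]
    | succ i =>
      have hv' : F.fiberDiff i j v = 0 := hv
      refine ⟨Ψ (i + 1 + 1) w - σ (i + 1) v, ?_⟩
      rw [map_sub, hΨ, hw, hσ, hv', map_zero, add_zero, add_sub_cancel_right]
  have hle : (F.boundaries i j).submoduleOf (F.cycles i j) ≤
      ((G.boundaries i j).submoduleOf (G.cycles i j)).comap ((Φ i).restrict hcyc) :=
    fun v hv => hbd v.1 hv
  refine LinearMap.finrank_le_finrank_of_injective (f := Submodule.mapQ _ _ _ hle) ?_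
  refine (injective_iff_map_eq_zero _).2 fun x hx => ?_
  obtain ⟨v, rfl⟩ := Submodule.Quotient.mk_surjective _ x
  rw [Submodule.mapQ_apply, Submodule.Quotient.mk_eq_zero] at hx
  rw [Submodule.Quotient.mk_eq_zero]
  exact hinj v.1 v.2 hx

end GradedFreeResolution

/-! ### Minimal resolutions -/

namespace Resolution

variable {k : Type*} [Field k] {n : ℕ} {I : Ideal (MvPolynomial (Fin n) k)}

lemma linearCombination_ε (F : Resolution I)
    (v : Fin (Fintype.card (F.ι 0)) → MvPolynomial (Fin n) k) :
    Fintype.linearCombination (MvPolynomial (Fin n) k)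
      (fun b => F.ε ((Fintype.equivFin _).symm b)) v = F.ε ⬝ᵥ (v ∘ Fintype.equivFin _) := by
  rw [dotProduct, ← (Fintype.equivFin _).symm.sum_comp, Fintype.linearCombination_apply]
  exact Finset.sum_congr rfl fun b _ => by simp [mul_comm]

/-- A `Resolution` as a graded free resolution, by enumeration of the basis elements. -/
noncomputable def toGradedFreeResolution (F : Resolution I) : GradedFreeResolution I where
  rank i := Fintype.card (F.ι i)
  deg i b := F.deg i ((Fintype.equivFin _).symm b)
  diff i := (F.d i).submatrix (Fintype.equivFin _).symm (Fintype.equivFin _).symm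
  aug := I.mkQ ∘ₗ Fintype.linearCombination (MvPolynomial (Fin n) k)
    (fun b => F.ε ((Fintype.equivFin _).symm b))
  diff_isForm i a b := F.isGraded_d i _ _
  aug_isForm b := ⟨F.ε ((Fintype.equivFin _).symm b), F.isForm_ε _, by
    rw [LinearMap.comp_apply, Fintype.linearCombination_apply_single, one_smul]; rfl⟩
  aug_surjective := by
    intro x
    obtain ⟨f, rfl⟩ := Submodule.mkQ_surjective _ x
    obtain ⟨v, hv⟩ := F.surjective f
    refine ⟨v ∘ (Fintype.equivFin _).symm, ?_⟩
    rw [LinearMap.comp_apply, linearCombination_ε]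
    refine ((Submodule.Quotient.eq I).2 ?_).symm
    simpa [Function.comp_def] using hv
  exact_zero := by
    intro v
    rw [LinearMap.comp_apply, linearCombination_ε]
    refine (Submodule.Quotient.mk_eq_zero I).trans ((F.exact_zero _).trans ⟨?_, ?_⟩)
    · rintro ⟨w, hw⟩
      refine ⟨w ∘ (Fintype.equivFin _).symm, ?_⟩
      rw [Matrix.mulVecLin_apply, Matrix.submatrix_mulVec_equiv]
      funext b
      simpa [Function.comp_def] using congrFun hw ((Fintype.equivFin _).symm b)
    · rintro ⟨w, rfl⟩
      refine ⟨w ∘ Fintype.equivFin _, ?_⟩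
      rw [Matrix.mulVecLin_apply, Matrix.submatrix_mulVec_equiv]
      funext b
      simp
  exact_succ i := by
    intro v
    rw [Matrix.mulVecLin_apply, Matrix.submatrix_mulVec_equiv]
    have h1 : ∀ {A : Type} [Fintype A] (u : A → MvPolynomial (Fin n) k),
        u ∘ (Fintype.equivFin A).symm = 0 ↔ u = 0 := fun u =>
      ⟨fun h => funext fun a => by simpa using congrFun h (Fintype.equivFin _ a),
        fun h => by rw [h]; rfl⟩
    rw [h1, F.exact_succ]
    constructor
    · rintro ⟨w, hw⟩
      refine ⟨w ∘ (Fintype.equivFin _).symm, ?_⟩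
      rw [Matrix.mulVecLin_apply, Matrix.submatrix_mulVec_equiv]
      funext b
      simpa [Function.comp_def] using congrFun hw ((Fintype.equivFin _).symm b)
    · rintro ⟨w, rfl⟩
      refine ⟨w ∘ Fintype.equivFin _, ?_⟩
      rw [Matrix.mulVecLin_apply, Matrix.submatrix_mulVec_equiv]
      funext b
      simp

/-- The number of basis elements of `F_i` of degree `j`. -/
def count (F : Resolution I) (i : ℕ) (j : ℤ) : ℕ := ∑ b, if F.deg i b = j then 1 else 0

/-- A resolution is minimal if the differential of `F ⊗_S k` is zero. -/
def IsMinimal (F : Resolution I) : Prop := ∀ i a b, constantCoeff (F.d i a b) = 0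

/-- For a minimal resolution, all of `F ⊗_S k` is its homology. -/
lemma IsMinimal.finrank_tor {F : Resolution I} (hF : F.IsMinimal) (i : ℕ) (j : ℤ) :
    Module.finrank k (F.toGradedFreeResolution.Tor i j) = F.count i j := by
  have hd : ∀ i, F.toGradedFreeResolution.fiberDiff i j = 0 := by
    intro i
    rw [GradedFreeResolution.fiberDiff_eq]
    refine (congrArg Matrix.mulVecLin (Matrix.ext fun a b => ?_)).trans Matrix.mulVecLin_zero
    exact hF i _ _
  have hb : F.toGradedFreeResolution.boundaries i j = ⊥ := by
    rw [GradedFreeResolution.boundaries, hd, LinearMap.range_zero]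
  have hc : F.toGradedFreeResolution.cycles i j = ⊤ := by
    cases i with
    | zero => rfl
    | succ i => exact (congrArg LinearMap.ker (hd i)).trans LinearMap.ker_zero
  have h1 := Submodule.finrank_quotient_add_finrank
    ((F.toGradedFreeResolution.boundaries i j).submoduleOf (F.toGradedFreeResolution.cycles i j))
  have h2 : (F.toGradedFreeResolution.boundaries i j).submoduleOf
      (F.toGradedFreeResolution.cycles i j) = ⊥ := by
    rw [hb]; exact Submodule.ker_subtype _
  have h3 : Module.finrank k ((F.toGradedFreeResolution.boundaries i j).submoduleOf
      (F.toGradedFreeResolution.cycles i j)) = 0 := by rw [h2, finrank_bot]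
  rw [h3, add_zero] at h1
  rw [h1, hc, finrank_top, Module.finrank_fintype_fun_eq_card, count, Fintype.card_subtype,
    Finset.card_filter]
  exact (Fintype.equivFin (F.ι i)).symm.sum_comp fun b => if F.deg i b = j then 1 else 0

end Resolution

/-- `S / I` has a minimal graded free resolution whose `i`-th module has `b i j` basis elements of
degree `j`. -/
def HasMinimalResolution {k : Type*} [Field k] {n : ℕ} (I : Ideal (MvPolynomial (Fin n) k))
    (b : ℕ → ℤ → ℕ) : Prop :=
  ∃ F : Resolution I, F.IsMinimal ∧ ∀ i j, F.count i j = b i j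

lemma HasMinimalResolution.hasBettiTable {k : Type*} [Field k] {n : ℕ}
    {I : Ideal (MvPolynomial (Fin n) k)} {b : ℕ → ℤ → ℕ} (h : HasMinimalResolution I b)
    {T : ℕ → ℤ → ℕ} (hT : ∀ i r, b i (i + r) = T i r) : HasBettiTable I T := by
  obtain ⟨F, hF, hc⟩ := h
  refine ⟨⟨F.toGradedFreeResolution⟩, fun G i r => ?_⟩
  rw [← hT, ← hc, ← hF.finrank_tor]
  exact le_antisymm (G.finrank_tor_le _ F.formComponent_mem _ _)
    (GradedFreeResolution.finrank_tor_le _ G F.formComponent_mem _ _)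

/-! ### Mapping cones -/

namespace Resolution

variable {k : Type*} [Field k] {n : ℕ} {J L : Ideal (MvPolynomial (Fin n) k)}

/-- The types of basis elements of a mapping cone. -/
def ConeIndex (A B : ℕ → Type) : ℕ → Type
  | 0 => A 0
  | i + 1 => A (i + 1) ⊕ B i

instance fintypeConeIndex (A B : ℕ → Type) [∀ i, Fintype (A i)] [∀ i, Fintype (B i)] :
    ∀ i, Fintype (ConeIndex A B i)
  | 0 => inferInstanceAs (Fintype (A 0))
  | i + 1 => inferInstanceAs (Fintype (A (i + 1) ⊕ B i))

/-- The degrees of the basis elements of the mapping cone of a chain map `K → G` of degree `e`. -/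
def coneDeg (G : Resolution J) (K : Resolution L) (e : ℤ) : ∀ i, ConeIndex G.ι K.ι i → ℤ
  | 0 => G.deg 0
  | i + 1 => Sum.elim (G.deg (i + 1)) (fun b => K.deg i b + e)

/-- The differential of the mapping cone of `φ : K → G`. -/
noncomputable def coneD (G : Resolution J) (K : Resolution L)
    (φ : ∀ i, Matrix (G.ι i) (K.ι i) (MvPolynomial (Fin n) k)) :
    ∀ i, Matrix (ConeIndex G.ι K.ι i) (ConeIndex G.ι K.ι (i + 1)) (MvPolynomial (Fin n) k)
  | 0 => Matrix.fromCols (G.d 0) (φ 0)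
  | i + 1 => Matrix.fromBlocks (G.d (i + 1)) (φ (i + 1)) 0 (-(K.d i))

lemma formComponent_mem_sup {q : MvPolynomial (Fin n) k} {e : ℤ} (hq : IsForm q e)
    (hJ : ∀ p ∈ J, ∀ d : ℤ, formComponent d p ∈ J) :
    ∀ p ∈ J ⊔ Ideal.span {q}, ∀ d : ℤ, formComponent d p ∈ J ⊔ Ideal.span {q} := by
  intro p hp d
  obtain ⟨a, ha, b, hb, rfl⟩ := Submodule.mem_sup.1 hp
  rw [map_add]
  refine Submodule.add_mem_sup (hJ a ha d) (formComponent_mem_span ?_ hb d)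
  rintro _ rfl
  exact ⟨e, hq⟩

lemma ε_dotProduct_sub_mem (G : Resolution J) (K : Resolution L) {q : MvPolynomial (Fin n) k}
    (φ : ∀ i, Matrix (G.ι i) (K.ι i) (MvPolynomial (Fin n) k))
    (hφε : ∀ b, (G.ε ᵥ* φ 0) b - K.ε b * q ∈ J) (u : K.ι 0 → MvPolynomial (Fin n) k) :
    G.ε ⬝ᵥ φ 0 *ᵥ u - (K.ε ⬝ᵥ u) * q ∈ J := by
  rw [Matrix.dotProduct_mulVec]
  simp only [dotProduct, Finset.sum_mul, ← Finset.sum_sub_distrib]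
  refine sum_mem fun b _ => ?_
  rw [show (G.ε ᵥ* φ 0) b * u b - K.ε b * u b * q = u b * ((G.ε ᵥ* φ 0) b - K.ε b * q) by ring]
  exact Ideal.mul_mem_left _ _ (hφε b)

/-- If `G` resolves `S / J` and `K` resolves `S / (J : q)`, then the mapping cone of a chain map
`K → G` lifting multiplication by `q` resolves `S / (J + (q))`. -/
noncomputable def cone (G : Resolution J) (K : Resolution L) {q : MvPolynomial (Fin n) k} {e : ℤ}
    (hq : IsForm q e) (hL : ∀ f, f ∈ L ↔ f * q ∈ J)
    (φ : ∀ i, Matrix (G.ι i) (K.ι i) (MvPolynomial (Fin n) k))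
    (hφ : ∀ i, IsGraded (φ i) (G.deg i) (fun b => K.deg i b + e))
    (hφε : ∀ b, (G.ε ᵥ* φ 0) b - K.ε b * q ∈ J)
    (hφd : ∀ i, G.d i * φ (i + 1) = φ i * K.d i) : Resolution (J ⊔ Ideal.span {q}) where
  ι := ConeIndex G.ι K.ι
  fintype := fintypeConeIndex G.ι K.ι
  deg := coneDeg G K e
  d := coneD G K φ
  ε := G.ε
  formComponent_mem := formComponent_mem_sup hq G.formComponent_mem
  isForm_ε := G.isForm_ε
  isGraded_d := by
    rintro (_ | i)
    · rintro a (b | b)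
      · exact G.isGraded_d 0 a b
      · exact hφ 0 a b
    · rintro (a | a) (b | b)
      · exact G.isGraded_d (i + 1) a b
      · exact hφ (i + 1) a b
      · exact IsForm.zero _
      · exact ((K.isGraded_d i).add_const e a b).neg
  surjective f := by
    obtain ⟨v, hv⟩ := G.surjective f
    exact ⟨v, Ideal.mem_sup_left hv⟩
  exact_zero := by
    intro (v : G.ι 0 → MvPolynomial (Fin n) k)
    constructor
    · intro hv
      obtain ⟨a, ha, b, hb, hab⟩ := Submodule.mem_sup.1 hv
      obtain ⟨c, rfl⟩ := Ideal.mem_span_singleton'.1 hb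
      obtain ⟨u, hu⟩ := K.surjective c
      have h1 : G.ε ⬝ᵥ (v - φ 0 *ᵥ u) ∈ J := by
        have h2 : G.ε ⬝ᵥ (v - φ 0 *ᵥ u) =
            a + (c - K.ε ⬝ᵥ u) * q - (G.ε ⬝ᵥ φ 0 *ᵥ u - (K.ε ⬝ᵥ u) * q) := by
          have hab' : a + c * q = G.ε ⬝ᵥ v := hab
          rw [dotProduct_sub, ← hab']
          ring
        rw [h2]
        exact sub_mem (add_mem ha ((hL _).1 hu)) (ε_dotProduct_sub_mem G K φ hφε u)
      obtain ⟨w, hw⟩ := (G.exact_zero _).1 h1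
      refine ⟨Sum.elim w u, ?_⟩
      change Matrix.fromCols (G.d 0) (φ 0) *ᵥ Sum.elim w u = v
      rw [Matrix.fromCols_mulVec_sumElim, hw, sub_add_cancel]
    · rintro ⟨w, rfl⟩
      obtain ⟨w, u, rfl⟩ : ∃ w' u, w = Sum.elim w' u := ⟨_, _, (Sum.elim_comp_inl_inr w).symm⟩
      change G.ε ⬝ᵥ (Matrix.fromCols (G.d 0) (φ 0) *ᵥ Sum.elim w u) ∈ _
      rw [Matrix.fromCols_mulVec_sumElim, dotProduct_add]
      refine add_mem (Ideal.mem_sup_left ((G.exact_zero _).2 ⟨w, rfl⟩)) ?_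
      rw [← sub_add_cancel (G.ε ⬝ᵥ φ 0 *ᵥ u) ((K.ε ⬝ᵥ u) * q)]
      exact add_mem (Ideal.mem_sup_left (ε_dotProduct_sub_mem G K φ hφε u))
        (Ideal.mem_sup_right (Ideal.mul_mem_left _ _ (Ideal.mem_span_singleton_self q)))
  exact_succ := by
    -- a cycle `(w, u)` of the cone is a boundary as soon as `u` is a boundary in `K`
    have key : ∀ i (w : G.ι (i + 1) → _) (u : K.ι i → _), G.d i *ᵥ w + φ i *ᵥ u = 0 →
        (∃ u', K.d i *ᵥ u' = u) → ∃ w' u', G.d (i + 1) *ᵥ w' + φ (i + 1) *ᵥ u' = w ∧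
          -(K.d i) *ᵥ u' = u := by
      rintro i w _ h ⟨u, rfl⟩
      rw [Matrix.mulVec_mulVec, ← hφd, ← Matrix.mulVec_mulVec, ← Matrix.mulVec_add] at h
      obtain ⟨w', hw'⟩ := (G.exact_succ i _).1 h
      refine ⟨w', -u, ?_, ?_⟩
      · rw [hw', Matrix.mulVec_neg, add_neg_cancel_right]
      · rw [Matrix.neg_mulVec, Matrix.mulVec_neg, neg_neg]
    -- the `G`-component of the square of the differential of the cone vanishes
    have key' : ∀ i (w : G.ι (i + 2) → _) (u : K.ι (i + 1) → _),
        G.d i *ᵥ (G.d (i + 1) *ᵥ w + φ (i + 1) *ᵥ u) + φ i *ᵥ (-(K.d i) *ᵥ u) = 0 := by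
      intro i w u
      rw [Matrix.mulVec_add, Matrix.mulVec_mulVec, Matrix.mulVec_mulVec, Matrix.mulVec_mulVec,
        d_mul_d, hφd, Matrix.mul_neg, Matrix.neg_mulVec, Matrix.zero_mulVec, zero_add,
        add_neg_cancel]
    rintro (_ | i) v
    · obtain ⟨w, u, rfl⟩ : ∃ w u, v = Sum.elim w u := ⟨_, _, (Sum.elim_comp_inl_inr v).symm⟩
      change Matrix.fromCols (G.d 0) (φ 0) *ᵥ Sum.elim w u = 0 ↔
        ∃ w', Matrix.fromBlocks (G.d 1) (φ 1) 0 (-(K.d 0)) *ᵥ w' = Sum.elim w u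
      rw [Matrix.fromCols_mulVec_sumElim]
      constructor
      · intro h
        have h1 : (K.ε ⬝ᵥ u) * q ∈ J := by
          have h2 : (K.ε ⬝ᵥ u) * q =
              -(G.ε ⬝ᵥ φ 0 *ᵥ u - (K.ε ⬝ᵥ u) * q) - G.ε ⬝ᵥ G.d 0 *ᵥ w := by
            rw [eq_neg_of_add_eq_zero_left h, dotProduct_neg]
            ring
          rw [h2]
          exact sub_mem (neg_mem (ε_dotProduct_sub_mem G K φ hφε u)) ((G.exact_zero _).2 ⟨w, rfl⟩)
        obtain ⟨w', u', h3, h4⟩ := key 0 w u h ((K.exact_zero _).1 ((hL _).2 h1))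
        refine ⟨Sum.elim w' u', ?_⟩
        rw [Matrix.fromBlocks_mulVec, Sum.elim_comp_inl, Sum.elim_comp_inr, Matrix.zero_mulVec,
          zero_add, h3, h4]
      · rintro ⟨v, hv⟩
        rw [Matrix.fromBlocks_mulVec, Matrix.zero_mulVec, zero_add] at hv
        rw [← (Sum.elim_eq_iff.1 hv).1, ← (Sum.elim_eq_iff.1 hv).2]
        exact key' 0 _ _
    · obtain ⟨w, u, rfl⟩ : ∃ w u, v = Sum.elim w u := ⟨_, _, (Sum.elim_comp_inl_inr v).symm⟩
      change Matrix.fromBlocks (G.d (i + 1)) (φ (i + 1)) 0 (-(K.d i)) *ᵥ Sum.elim w u = 0 ↔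
        ∃ w', Matrix.fromBlocks (G.d (i + 2)) (φ (i + 2)) 0 (-(K.d (i + 1))) *ᵥ w' = Sum.elim w u
      rw [Matrix.fromBlocks_mulVec, Sum.elim_comp_inl, Sum.elim_comp_inr, Matrix.zero_mulVec,
        zero_add]
      constructor
      · intro h
        have h0 : Sum.elim (G.d (i + 1) *ᵥ w + φ (i + 1) *ᵥ u) (-(K.d i) *ᵥ u) =
          Sum.elim (0 : G.ι (i + 1) → MvPolynomial (Fin n) k) 0 := h.trans Sum.elim_zero_zero.symm
        obtain ⟨h1, h2⟩ := Sum.elim_eq_iff.1 h0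
        rw [Matrix.neg_mulVec, neg_eq_zero] at h2
        obtain ⟨w', u', h3, h4⟩ := key (i + 1) w u h1 ((K.exact_succ i _).1 h2)
        refine ⟨Sum.elim w' u', ?_⟩
        rw [Matrix.fromBlocks_mulVec, Sum.elim_comp_inl, Sum.elim_comp_inr, Matrix.zero_mulVec,
          zero_add, h3, h4]
      · rintro ⟨v, hv⟩
        rw [Matrix.fromBlocks_mulVec, Matrix.zero_mulVec, zero_add] at hv
        rw [← (Sum.elim_eq_iff.1 hv).1, ← (Sum.elim_eq_iff.1 hv).2, key' (i + 1),
          Matrix.mulVec_mulVec, Matrix.neg_mul, Matrix.mul_neg, neg_neg, d_mul_d,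
          Matrix.zero_mulVec]
        exact Sum.elim_zero_zero

end Resolution

/-- The Betti numbers of a mapping cone, in terms of those of its target and of its source, the
latter being shifted by `e` in internal degree and by `1` in homological degree. -/
def coneTable (b c : ℕ → ℤ → ℕ) (e : ℤ) : ℕ → ℤ → ℕ
  | 0, j => b 0 j
  | i + 1, j => b (i + 1) j + c i (j - e)

variable {k : Type*} [Field k] {n : ℕ}

/-- A mapping cone is minimal if no basis element of the shifted source has the same homological and
internal degree as one of the target. -/
lemma HasMinimalResolution.cone {J L : Ideal (MvPolynomial (Fin n) k)} {b c : ℕ → ℤ → ℕ}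
    (hJ : HasMinimalResolution J b) (hL : HasMinimalResolution L c) {q : MvPolynomial (Fin n) k}
    {e : ℕ} (hq : q.IsHomogeneous e) (hcolon : ∀ f, f ∈ L ↔ f * q ∈ J)
    (hbc : ∀ i j, b i j ≠ 0 → c i (j - e) = 0) :
    HasMinimalResolution (J ⊔ Ideal.span {q}) (coneTable b c e) := by
  obtain ⟨G, hG, hGb⟩ := hJ
  obtain ⟨K, hK, hKc⟩ := hL
  have hq' := isForm_of_isHomogeneous hq
  obtain ⟨φ, hφ, hφε, hφd⟩ := K.exists_chainMap G hq' fun f hf => (hcolon f).1 hf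
  have h0 : ∀ i a b, constantCoeff (φ i a b) = 0 := by
    intro i a b'
    refine (hφ i a b').constantCoeff_eq_zero fun h => ?_
    have h : K.deg i b' + e - G.deg i a = 0 := h
    have h1 : b i (G.deg i a) ≠ 0 := by
      rw [← hGb, Resolution.count]
      exact fun h => by simpa using (Finset.sum_eq_zero_iff.1 h) a (Finset.mem_univ _)
    have h2 := hbc _ _ h1
    rw [← hKc, Resolution.count, Finset.sum_eq_zero_iff] at h2
    have h3 := h2 b' (Finset.mem_univ _)
    rw [if_pos (by omega)] at h3
    exact one_ne_zero h3
  refine ⟨G.cone K hq' hcolon φ hφ hφε hφd, ?_, ?_⟩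
  · rintro (_ | i)
    · rintro a (b | b)
      · exact hG 0 a b
      · exact h0 0 a b
    · rintro (a | a) (b | b)
      · exact hG (i + 1) a b
      · exact h0 (i + 1) a b
      · exact map_zero _
      · exact (map_neg _ _).trans (by rw [hK, neg_zero])
  · rintro (_ | i) j
    · exact hGb 0 j
    · rw [coneTable, ← hGb, ← hKc]
      refine (Fintype.sum_sum_type _).trans (congrArg₂ _ rfl ?_)
      refine Finset.sum_congr rfl fun x _ => ?_
      change (if K.deg i x + e = j then 1 else 0) = if K.deg i x = j - e then 1 else 0
      exact if_congr (by omega) rfl rfl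

/-- The ring `S` is its own minimal resolution. -/
lemma hasMinimalResolution_bot : HasMinimalResolution (⊥ : Ideal (MvPolynomial (Fin n) k))
    (fun i j => if i = 0 ∧ j = 0 then 1 else 0) := by
  let ι : ℕ → Type := fun i => {_x : Unit // i = 0}
  have hι : ∀ i, IsEmpty (ι (i + 1)) := fun i => ⟨fun x => by simpa using x.2⟩
  refine ⟨{ ι := ι, fintype := fun i => inferInstance, deg := fun _ _ => 0, d := fun i => 0,
            ε := fun _ => 1, formComponent_mem := ?_, isForm_ε := fun _ => IsForm.one,
            isGraded_d := fun _ _ _ => IsForm.zero _, surjective := ?_, exact_zero := ?_,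
            exact_succ := ?_ }, fun _ _ _ => map_zero _, ?_⟩
  · rintro p hp d
    rw [Ideal.mem_bot] at hp ⊢
    rw [hp, map_zero]
  · exact fun f => ⟨fun _ => f, by simp [dotProduct, ι]⟩
  · intro v
    have : v = fun _ => v ⟨(), rfl⟩ := rfl
    rw [this]
    simp [dotProduct, ι, funext_iff, eq_comm]
  · intro i v
    refine ⟨fun _ => ⟨0, funext fun x => (hι i).elim x⟩, fun _ => by simp⟩
  · intro i j
    change ∑ b : ι i, _ = _
    by_cases hi : i = 0
    · subst hi
      simp [ι, eq_comm]
    · have : IsEmpty (ι i) := ⟨fun x => hi x.2⟩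
      simp [hi]

/-! ### Ideals generated by linear forms -/

section LinearForms

variable {k : Type*} [Field k] {n : ℕ}

/-- Linear forms generate the kernel of an algebra endomorphism of `S`, which substitutes for the
variables their images under a projection with kernel the span of these forms. The same
endomorphism shows that the ideal contains no further linear forms. -/
lemma exists_algHom_ker_eq_span {s : Set (MvPolynomial (Fin n) k)}
    (hs : ∀ p ∈ s, p.IsHomogeneous 1) :
    ∃ Φ : MvPolynomial (Fin n) k →ₐ[k] MvPolynomial (Fin n) k,
      RingHom.ker Φ = Ideal.span s ∧
      ∀ p : MvPolynomial (Fin n) k, p.IsHomogeneous 1 → Φ p = 0 → p ∈ Submodule.span k s := by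
  obtain ⟨C, hC⟩ := Submodule.exists_isCompl (Submodule.span k s)
  let π : MvPolynomial (Fin n) k →ₗ[k] MvPolynomial (Fin n) k :=
    C.projection (Submodule.span k s) hC.symm
  have hπ : ∀ p, π p = 0 ↔ p ∈ Submodule.span k s := by
    intro p
    simp [π]
  have hπ' : ∀ p, p - π p ∈ Submodule.span k s := by
    intro p
    have h : π (π p) = π p := 
      Submodule.projection_apply_left hC.symm ⟨π p, Submodule.projection_apply_mem hC.symm p⟩
    rw [← hπ, map_sub, h, sub_self]
  let Φ : MvPolynomial (Fin n) k →ₐ[k] MvPolynomial (Fin n) k := aeval fun i => π (X i)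
  have hlin : ∀ p : MvPolynomial (Fin n) k, p.IsHomogeneous 1 → Φ p = π p := by
    intro p hp
    have hp' : p ∈ homogeneousSubmodule (Fin n) k 1 := hp
    rw [homogeneousSubmodule_one_eq_span_X] at hp'
    refine LinearMap.eqOn_span (f := Φ.toLinearMap) (g := π) ?_ hp'
    rintro _ ⟨i, rfl⟩
    simp [Φ]
  have hle : Submodule.span k s ≤ (Ideal.span s).restrictScalars k :=
    Submodule.span_le.2 Ideal.subset_span
  have hmk : (Ideal.Quotient.mkₐ k (Ideal.span s)).comp Φ =
      Ideal.Quotient.mkₐ k (Ideal.span s) := by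
    refine MvPolynomial.algHom_ext fun i => ?_
    simp only [AlgHom.comp_apply, Ideal.Quotient.mkₐ_eq_mk, Φ, aeval_X]
    exact (Ideal.Quotient.eq.2 (hle (hπ' (X i)))).symm
  refine ⟨Φ, le_antisymm (fun p hp => ?_) (Ideal.span_le.2 fun p hp => ?_), fun p hp h => ?_⟩
  · rw [← Ideal.Quotient.eq_zero_iff_mem, ← Ideal.Quotient.mkₐ_eq_mk k, ← hmk, AlgHom.comp_apply,
      show Φ p = 0 from hp, map_zero]
  · exact (hlin p (hs p hp)).trans ((hπ p).2 (Submodule.subset_span hp))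
  · exact (hπ p).1 ((hlin p hp).symm.trans h)

/-- The quotient by linear forms embeds into the domain `S`. -/
lemma isPrime_span_of_isHomogeneous_one {s : Set (MvPolynomial (Fin n) k)}
    (hs : ∀ p ∈ s, p.IsHomogeneous 1) : (Ideal.span s).IsPrime := by
  obtain ⟨Φ, hΦ, -⟩ := exists_algHom_ker_eq_span hs
  rw [← hΦ]
  exact RingHom.ker_isPrime Φ

lemma mem_span_of_isHomogeneous_one {s : Set (MvPolynomial (Fin n) k)}
    (hs : ∀ p ∈ s, p.IsHomogeneous 1) {p : MvPolynomial (Fin n) k} (hp : p.IsHomogeneous 1)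
    (h : p ∈ Ideal.span s) : p ∈ Submodule.span k s := by
  obtain ⟨Φ, hΦ, hΦ'⟩ := exists_algHom_ker_eq_span hs
  rw [← hΦ] at h
  exact hΦ' p hp h

lemma notMem_ideal_span_image {ι : Type*} {a : ι → MvPolynomial (Fin n) k}
    (ha : ∀ i, (a i).IsHomogeneous 1) (hli : LinearIndependent k a) {s : Set ι} {i : ι}
    (hi : i ∉ s) : a i ∉ Ideal.span (a '' s) := fun h =>
  hli.notMem_span_image hi
    (mem_span_of_isHomogeneous_one (by rintro _ ⟨j, -, rfl⟩; exact ha j) (ha i) h)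

open scoped Pointwise in
/-- The products of the `a i` with a fixed `x` generate the ideal `x · (a)`. -/
lemma mul_mem_span_range_mul_iff {ι : Type*} {a : ι → MvPolynomial (Fin n) k}
    {x : MvPolynomial (Fin n) k} {f : MvPolynomial (Fin n) k} :
    f ∈ Ideal.span (Set.range fun i => a i * x) ↔ ∃ p ∈ Ideal.span (Set.range a), p * x = f := by
  have h : (Set.range fun i => a i * x) = Set.range a * ({x} : Set (MvPolynomial (Fin n) k)) := by
    rw [Set.mul_singleton, ← Set.range_comp]; rfl
  rw [h, ← Ideal.span_mul_span', Ideal.mem_mul_span_singleton]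

lemma ideal_span_range_succ {m : ℕ} (a : Fin (m + 1) → MvPolynomial (Fin n) k) :
    Ideal.span (Set.range a) =
      Ideal.span (Set.range (Fin.init a)) ⊔ Ideal.span {a (Fin.last m)} := by
  rw [← Ideal.span_union]
  congr 1
  ext p
  simp [Fin.exists_fin_succ', Fin.init, or_comm, eq_comm]

end LinearForms

/-! ### Linear resolutions -/

section LinearResolutions

variable {k : Type*} [Field k] {n : ℕ}

/-- The Betti numbers of the Koszul complex on `m` linear forms. -/
def koszulTable (m i : ℕ) (j : ℤ) : ℕ := if j = i then m.choose i else 0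

/-- The Betti numbers of `S / (x a_1, …, x a_m)`. -/
def mulKoszulTable (m i : ℕ) (j : ℤ) : ℕ :=
  if i = 0 then (if j = 0 then 1 else 0) else if j = i + 1 then m.choose i else 0

lemma HasMinimalResolution.congr {I I' : Ideal (MvPolynomial (Fin n) k)} {b b' : ℕ → ℤ → ℕ}
    (h : HasMinimalResolution I b) (hI : I = I') (hb : ∀ i j, b i j = b' i j) :
    HasMinimalResolution I' b' := by
  obtain rfl : b = b' := funext fun i => funext (hb i)
  exact hI ▸ h

/-- Linearly independent linear forms are a regular sequence, since all their initial segments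
generate prime ideals; the Koszul complex arises as an iterated mapping cone. -/
lemma hasMinimalResolution_span_range {m : ℕ} {a : Fin m → MvPolynomial (Fin n) k}
    (ha : ∀ i, (a i).IsHomogeneous 1) (hli : LinearIndependent k a) :
    HasMinimalResolution (Ideal.span (Set.range a)) (koszulTable m) := by
  induction m with
  | zero =>
    rw [Set.range_eq_empty, Ideal.span_empty]
    refine hasMinimalResolution_bot.congr rfl fun i j => ?_
    rcases i with _ | i <;> simp [koszulTable]
  | succ m ih =>
    rw [linearIndependent_finSucc'] at hli
    have hhom : ∀ p ∈ Set.range (Fin.init a), p.IsHomogeneous 1 := by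
      rintro _ ⟨i, rfl⟩
      exact ha _
    have hprime := isPrime_span_of_isHomogeneous_one hhom
    have hnot : a (Fin.last m) ∉ Ideal.span (Set.range (Fin.init a)) := fun h =>
      hli.2 (mem_span_of_isHomogeneous_one hhom (ha _) h)
    have hK := ih (a := Fin.init a) (fun i => ha _) hli.1
    refine (hK.cone hK (ha (Fin.last m)) (fun f => ⟨fun h => Ideal.mul_mem_right _ _ h,
      fun h => (hprime.mem_or_mem h).resolve_right hnot⟩) ?_).congr
        (ideal_span_range_succ a).symm ?_
    · intro i j h
      simp only [koszulTable] at h ⊢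
      push_cast at *
      split_ifs at h ⊢ <;> omega
    · intro i j
      rcases i with _ | i
      · simp [koszulTable, coneTable]
      · simp only [koszulTable, coneTable, Nat.choose_succ_succ']
        push_cast
        split_ifs <;> omega

/-- The colon ideals `(x a_1, …, x a_m) : x a_{m+1}` and `(a_1, …, a_m)` agree. -/
lemma hasMinimalResolution_span_range_mul {m : ℕ} {a : Fin m → MvPolynomial (Fin n) k}
    {x : MvPolynomial (Fin n) k} (ha : ∀ i, (a i).IsHomogeneous 1) (hli : LinearIndependent k a)
    (hx : x.IsHomogeneous 1) (hx0 : x ≠ 0) :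
    HasMinimalResolution (Ideal.span (Set.range fun i => a i * x)) (mulKoszulTable m) := by
  induction m with
  | zero =>
    rw [Set.range_eq_empty, Ideal.span_empty]
    refine hasMinimalResolution_bot.congr rfl fun i j => ?_
    rcases i with _ | i <;> simp [mulKoszulTable]
  | succ m ih =>
    rw [linearIndependent_finSucc'] at hli
    have hhom : ∀ p ∈ Set.range (Fin.init a), p.IsHomogeneous 1 := by
      rintro _ ⟨i, rfl⟩
      exact ha _
    have hprime := isPrime_span_of_isHomogeneous_one hhom
    have hnot : a (Fin.last m) ∉ Ideal.span (Set.range (Fin.init a)) := fun h =>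
      hli.2 (mem_span_of_isHomogeneous_one hhom (ha _) h)
    have hK := hasMinimalResolution_span_range (a := Fin.init a) (fun i => ha _) hli.1
    have hJ := ih (a := Fin.init a) (fun i => ha _) hli.1
    refine (hJ.cone hK ((ha (Fin.last m)).mul hx) (fun f => ?_) ?_).congr
      (ideal_span_range_succ fun i => a i * x).symm ?_
    · rw [mul_mem_span_range_mul_iff]
      constructor
      · exact fun h => ⟨_, Ideal.mul_mem_right _ _ h, mul_assoc _ _ _⟩
      · rintro ⟨p, hp, h⟩
        rw [← mul_assoc] at h
        rw [mul_right_cancel₀ hx0 h] at hp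
        exact (hprime.mem_or_mem hp).resolve_right hnot
    · intro i j h
      simp only [mulKoszulTable, koszulTable] at h ⊢
      push_cast at *
      split_ifs at h ⊢ <;> omega
    · intro i j
      rcases i with _ | i
      · simp [mulKoszulTable, coneTable]
      · simp only [mulKoszulTable, koszulTable, coneTable, Nat.choose_succ_succ']
        push_cast
        split_ifs <;> omega

lemma hasMinimalResolution_span_singleton {x : MvPolynomial (Fin n) k} (hx : x.IsHomogeneous 1)
    (hx0 : x ≠ 0) : HasMinimalResolution (Ideal.span {x}) (koszulTable 1) := by
  have h := hasMinimalResolution_span_range (a := fun _ : Fin 1 => x) (fun _ => hx)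
    (linearIndependent_unique_iff.2 hx0)
  rwa [Set.range_const] at h

lemma hasMinimalResolution_span_pair {x y : MvPolynomial (Fin n) k} (hx : x.IsHomogeneous 1)
    (hy : y.IsHomogeneous 1) (hli : LinearIndependent k ![x, y]) :
    HasMinimalResolution (Ideal.span {x, y}) (koszulTable 2) := by
  have h := hasMinimalResolution_span_range (a := ![x, y])
    (by intro i; fin_cases i <;> assumption) hli
  rwa [Matrix.range_cons_cons_empty] at h

end LinearResolutions

/-! ### The number of generators -/

section Generators

variable {k : Type*} [Field k] {n : ℕ}

/-- A quadric in an ideal generated by quadrics is a linear combination of them: only the constant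
terms of the coefficients contribute. -/
lemma mem_span_of_isHomogeneous_two {ι : Type*} [Finite ι] {h : ι → MvPolynomial (Fin n) k}
    (hh : ∀ i, (h i).IsHomogeneous 2) {f : MvPolynomial (Fin n) k} (hf : f.IsHomogeneous 2)
    (hmem : f ∈ Ideal.span (Set.range h)) : f ∈ Submodule.span k (Set.range h) := by
  cases nonempty_fintype ι
  obtain ⟨c, rfl⟩ := Ideal.mem_span_range_iff_exists_fun.1 hmem
  rw [← (isForm_of_isHomogeneous hf).formComponent_eq, map_sum]
  refine sum_mem fun i _ => ?_
  rw [mul_comm, (isForm_of_isHomogeneous (hh i)).formComponent_mul, sub_self]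
  have h0 : formComponent 0 (c i) = C (constantCoeff (c i)) := by
    simp [formComponent, homogeneousComponent_zero, constantCoeff_eq]
  rw [h0, mul_comm, ← MvPolynomial.smul_eq_C_mul]
  exact Submodule.smul_mem _ _ (Submodule.subset_span ⟨i, rfl⟩)

/-- A minimal system of generating quadrics is linearly independent over `k`, and lies in the
`k`-span of any other system of generating quadrics. -/
lemma IsMinimallyGeneratedByQuadrics.le_card {I : Ideal (MvPolynomial (Fin n) k)} {g m : ℕ}
    (hI : IsMinimallyGeneratedByQuadrics I g) {h : Fin m → MvPolynomial (Fin n) k}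
    (hh : ∀ i, (h i).IsHomogeneous 2) (hspan : I = Ideal.span (Set.range h)) : g ≤ m := by
  obtain ⟨f, hf, hfI, hmin⟩ := hI
  have hli : LinearIndependent k f := by
    rw [linearIndependent_iff_notMem_span]
    intro i hi
    refine hmin i ?_
    have hle : Submodule.span k (f '' {i}ᶜ) ≤ (Ideal.span (f '' {i}ᶜ)).restrictScalars k :=
      Submodule.span_le.2 Ideal.subset_span
    rw [← Set.compl_eq_univ_sdiff] at hi
    exact hle hi
  have hle : Submodule.span k (Set.range f) ≤ Submodule.span k (Set.range h) := by
    rw [Submodule.span_le]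
    rintro _ ⟨i, rfl⟩
    refine mem_span_of_isHomogeneous_two hh (hf i) ?_
    rw [← hspan, ← hfI]
    exact Ideal.subset_span ⟨i, rfl⟩
  have h1 := finrank_span_eq_card hli
  have h2 := finrank_range_le_card (R := k) h
  have : FiniteDimensional k (Submodule.span k (Set.range h)) :=
    FiniteDimensional.span_of_finite k (Set.finite_range h)
  have h3 := Submodule.finrank_mono hle
  simp only [Fintype.card_fin] at h1 h2
  rw [Set.finrank] at h2
  omega

/-- An ideal `(a_1 x, …, a_m x, q)` with at least two minimal generators has `x ≠ 0`, since
otherwise it is generated by `q`. -/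
lemma IsMinimallyGeneratedByQuadrics.ne_zero {ι : Type*} {I : Ideal (MvPolynomial (Fin n) k)}
    {g : ℕ} (hI : IsMinimallyGeneratedByQuadrics I g) (hg : 2 ≤ g)
    {a : ι → MvPolynomial (Fin n) k} {x q : MvPolynomial (Fin n) k} (hq : q.IsHomogeneous 2)
    (h : I = Ideal.span (Set.range fun i => a i * x) ⊔ Ideal.span {q}) : x ≠ 0 := by
  rintro rfl
  have h0 : Ideal.span (Set.range fun i => a i * (0 : MvPolynomial (Fin n) k)) = ⊥ := by
    rw [Ideal.span_eq_bot]
    rintro _ ⟨i, rfl⟩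
    simp
  have := hI.le_card (h := fun _ : Fin 1 => q) (fun _ => hq)
    (by rw [h, h0, bot_sup_eq, Set.range_const])
  omega

end Generators

/-! ### The Betti tables of the three forms -/

section Tables

variable {k : Type*} [Field k] {n g : ℕ} {I : Ideal (MvPolynomial (Fin n) k)}

/-- As `q` is a nonzerodivisor modulo `J = x · (a)`, the colon ideal `J : q` is `J` itself. -/
lemma IsOfFormIi.hasBettiTable (h : IsOfFormIi I g) (hI : IsMinimallyGeneratedByQuadrics I g)
    (hg : 4 ≤ g) : HasBettiTable I (twoRowTable g) := by
  obtain ⟨a, x, q, ha, hli, hx, hq, rfl, hnzd⟩ := h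
  have hx0 := hI.ne_zero (by omega) hq rfl
  have hJ := hasMinimalResolution_span_range_mul ha hli hx hx0
  refine (hJ.cone hJ hq (fun f => ⟨fun h => Ideal.mul_mem_right _ _ h, fun h => ?_⟩)
    ?_).hasBettiTable ?_
  · rw [← Ideal.Quotient.eq_zero_iff_mem, map_mul] at h
    exact Ideal.Quotient.eq_zero_iff_mem.1 ((mem_nonZeroDivisors_iff_right.1 hnzd) _ h)
  · intro i j h
    simp only [mulKoszulTable] at h ⊢
    push_cast at *
    split_ifs at h ⊢ <;> omega
  · intro i r
    rcases i with _ | _ | i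
    · simp [coneTable, mulKoszulTable, twoRowTable]
    · simp only [coneTable, mulKoszulTable, twoRowTable]
      push_cast
      split_ifs <;> first | omega | (simp_all; omega)
    · simp only [coneTable, mulKoszulTable, twoRowTable]
      push_cast
      split_ifs <;> omega

/-- As `q` lies in `(a)` but not in the prime ideal `(x)`, the colon ideal of `J = x · (a)` by `q`
is `(x)`. -/
lemma IsOfFormIb.hasBettiTable (h : IsOfFormIb I g) (hI : IsMinimallyGeneratedByQuadrics I g)
    (hg : 4 ≤ g) : HasBettiTable I (linearTable g) := by
  obtain ⟨a, x, q, ha, hli, hx, hq, rfl, hqa, hqx⟩ := h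
  have hx0 := hI.ne_zero (by omega) hq rfl
  have hJ := hasMinimalResolution_span_range_mul ha hli hx hx0
  have hprime : (Ideal.span {x}).IsPrime :=
    isPrime_span_of_isHomogeneous_one (by rintro _ rfl; exact hx)
  refine (hJ.cone (hasMinimalResolution_span_singleton hx hx0) hq (fun f => ?_) ?_).hasBettiTable ?_
  · rw [mul_mem_span_range_mul_iff]
    constructor
    · intro h
      obtain ⟨c, rfl⟩ := Ideal.mem_span_singleton'.1 h
      exact ⟨c * q, Ideal.mul_mem_left _ _ hqa, by ring⟩
    · rintro ⟨p, -, h⟩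
      exact (hprime.mem_or_mem (Ideal.mem_span_singleton'.2 ⟨p, h⟩)).resolve_right hqx
  · intro i j h
    simp only [mulKoszulTable, koszulTable] at h ⊢
    push_cast at *
    split_ifs at h ⊢ <;> omega
  · intro i r
    rcases i with _ | _ | _ | i
    · simp [coneTable, mulKoszulTable, linearTable]
    · simp only [coneTable, mulKoszulTable, koszulTable, linearTable]
      push_cast
      split_ifs <;> first | omega | (simp_all; omega)
    · simp only [coneTable, mulKoszulTable, koszulTable, linearTable]
      push_cast
      split_ifs <;> first | omega | simp_all
    · simp only [coneTable, mulKoszulTable, koszulTable, linearTable,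
        Nat.choose_eq_zero_of_lt (show 1 < i + 1 + 1 by omega)]
      push_cast
      split_ifs <;> first | omega | simp_all

/-- The Betti table of an ideal arising by two mapping cones from an ideal `J = x · (a_1, a_2)`,
with first colon ideal `L₁` generated by one linear form and second colon ideal `L₂` generated by two.
Both `(x, y) ∩ (z, w)` and `((x, y)², x z + y w)` arise in this way. -/
lemma hasBettiTable_of_two_cones {J L₁ L₂ : Ideal (MvPolynomial (Fin n) k)}
    {q₁ q₂ : MvPolynomial (Fin n) k} (hJ : HasMinimalResolution J (mulKoszulTable 2))
    (hL₁ : HasMinimalResolution L₁ (koszulTable 1)) (hL₂ : HasMinimalResolution L₂ (koszulTable 2))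
    (hq₁ : q₁.IsHomogeneous 2) (hq₂ : q₂.IsHomogeneous 2) (h₁ : ∀ f, f ∈ L₁ ↔ f * q₁ ∈ J)
    (h₂ : ∀ f, f ∈ L₂ ↔ f * q₂ ∈ J ⊔ Ideal.span {q₁}) :
    HasBettiTable (J ⊔ Ideal.span {q₁} ⊔ Ideal.span {q₂}) (linearTable 4) := by
  refine ((hJ.cone hL₁ hq₁ h₁ ?_).cone hL₂ hq₂ h₂ ?_).hasBettiTable ?_
  · intro i j h
    simp only [mulKoszulTable, koszulTable] at h ⊢
    push_cast at *
    split_ifs at h ⊢ <;> omega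
  · rintro (_ | i) j h
    all_goals
      simp only [mulKoszulTable, koszulTable, coneTable] at h ⊢
      push_cast at *
      split_ifs at h ⊢ <;> omega
  · intro i r
    rcases i with _ | _ | _ | _ | i
    · simp [coneTable, mulKoszulTable, linearTable]
    all_goals
      simp only [coneTable, mulKoszulTable, koszulTable, linearTable]
      push_cast
      split_ifs <;> first | omega | simp_all [Nat.choose]

/-- The hypotheses, which hold for linearly independent linear forms, make `z, w` a regular sequence
modulo `(x, y)`. -/
lemma span_pair_inf_span_pair {x y z w : MvPolynomial (Fin n) k}
    (h1 : (Ideal.span {x, y}).IsPrime) (h2 : (Ideal.span {x, y, z}).IsPrime)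
    (hz : z ∉ Ideal.span {x, y}) (hw : w ∉ Ideal.span {x, y, z}) :
    Ideal.span {x, y} ⊓ Ideal.span {z, w} = Ideal.span {x, y} * Ideal.span {z, w} := by
  refine le_antisymm ?_ Ideal.mul_le_inf
  rintro f ⟨hf1, hf2⟩
  obtain ⟨α, β, rfl⟩ := Ideal.mem_span_pair.1 hf2
  have hle : Ideal.span {x, y} ≤ Ideal.span {x, y, z} := Ideal.span_mono (by grind)
  have hβ : β ∈ Ideal.span {x, y, z} := by
    refine (h2.mem_or_mem ?_).resolve_right hw
    rw [← add_sub_cancel_left (α * z) (β * w)]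
    exact sub_mem (hle hf1) (Ideal.mul_mem_left _ _ (Ideal.subset_span (by simp)))
  obtain ⟨b₁, hb₁, b₂, hb₂, rfl⟩ : ∃ b₁ ∈ Ideal.span {x, y}, ∃ b₂ ∈ Ideal.span {z},
      b₁ + b₂ = β := by
    rw [← Submodule.mem_sup, ← Ideal.span_union]
    convert hβ using 2
    ext; simp; grind
  obtain ⟨c, rfl⟩ := Ideal.mem_span_singleton'.1 hb₂
  have hα : α + c * w ∈ Ideal.span {x, y} := by
    refine (h1.mem_or_mem ?_).resolve_right hz
    rw [show (α + c * w) * z = α * z + (b₁ + c * z) * w - b₁ * w by ring]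
    exact sub_mem hf1 (Ideal.mul_mem_right _ _ hb₁)
  rw [show α * z + (b₁ + c * z) * w = (α + c * w) * z + b₁ * w by ring]
  exact add_mem (Ideal.mul_mem_mul hα (Ideal.subset_span (by simp)))
    (Ideal.mul_mem_mul hb₁ (Ideal.subset_span (by simp)))

/-- Here `J = (x z, x w)`, and `y z` and `y w` are added with colon ideals `(x)` and `(x, z)`. As `I`
is generated by four quadrics, `g ≤ 4`. -/
lemma hasBettiTable_inf {x y z w : MvPolynomial (Fin n) k} (hx : x.IsHomogeneous 1)
    (hy : y.IsHomogeneous 1) (hz : z.IsHomogeneous 1) (hw : w.IsHomogeneous 1)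
    (hli : LinearIndependent k ![x, y, z, w])
    (hI : IsMinimallyGeneratedByQuadrics I g) (hg : 4 ≤ g)
    (h : I = Ideal.span {x, y} ⊓ Ideal.span {z, w}) : HasBettiTable I (linearTable g) := by
  have hhom : ∀ i, (![x, y, z, w] i).IsHomogeneous 1 := by
    intro i; fin_cases i <;> assumption
  have hprime : ∀ s : Set (Fin 4), (Ideal.span (![x, y, z, w] '' s)).IsPrime := fun s =>
    isPrime_span_of_isHomogeneous_one (by rintro _ ⟨i, -, rfl⟩; exact hhom i)
  have hnot : ∀ (i : Fin 4) (s : Set (Fin 4)), i ∉ s →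
      ![x, y, z, w] i ∉ Ideal.span (![x, y, z, w] '' s) :=
    fun i s hi => notMem_ideal_span_image hhom hli hi
  have hpair : ∀ i j : Fin 4, i ≠ j →
      LinearIndependent k ![![x, y, z, w] i, ![x, y, z, w] j] := by
    intro i j hij
    convert hli.comp ![i, j] (by intro a b; fin_cases a <;> fin_cases b <;> simp [hij, hij.symm])
      using 1
    funext a; fin_cases a <;> rfl
  have hx0 : x ≠ 0 := hli.ne_zero 0
  -- the prime ideals `(x)`, `(x, y)`, `(x, z)`, `(x, y, z)` and the linear forms outside
  have px : (Ideal.span {x}).IsPrime := by simpa using hprime {0}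
  have pxy : (Ideal.span {x, y}).IsPrime := by simpa [Set.image_pair] using hprime {0, 1}
  have pxz : (Ideal.span {x, z}).IsPrime := by simpa [Set.image_pair] using hprime {0, 2}
  have pxyz : (Ideal.span {x, y, z}).IsPrime := by
    simpa [Set.image_insert_eq] using hprime {0, 1, 2}
  have yx : y ∉ Ideal.span {x} := by simpa using hnot 1 {0} (by simp)
  have zx : z ∉ Ideal.span {x} := by simpa using hnot 2 {0} (by simp)
  have zxy : z ∉ Ideal.span {x, y} := by simpa [Set.image_pair] using hnot 2 {0, 1} (by simp)
  have yxz : y ∉ Ideal.span {x, z} := by simpa [Set.image_pair] using hnot 1 {0, 2} (by simp)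
  have wxz : w ∉ Ideal.span {x, z} := by simpa [Set.image_pair] using hnot 3 {0, 2} (by simp)
  have wxyz : w ∉ Ideal.span {x, y, z} := by
    simpa [Set.image_insert_eq] using hnot 3 {0, 1, 2} (by simp)
  have hLx := hasMinimalResolution_span_singleton hx hx0
  -- membership in `x · (a₁, a₂)`
  have hmul : ∀ a : Fin 2 → MvPolynomial (Fin n) k, ∀ i f,
      f * (a i * x) ∈ Ideal.span (Set.range fun i => a i * x) := fun a i f =>
    Ideal.mul_mem_left _ _ (Ideal.subset_span ⟨i, rfl⟩)
  rw [span_pair_inf_span_pair pxy pxyz zxy wxyz, Ideal.span_pair_mul_span_pair] at h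
  have hg4 : g ≤ 4 := by
    refine hI.le_card (h := ![x * z, x * w, y * z, y * w]) ?_ ?_
    · intro i
      fin_cases i
      exacts [hx.mul hz, hx.mul hw, hy.mul hz, hy.mul hw]
    · rw [h]
      congr 1
      ext; simp [Matrix.range_cons]; grind
  obtain rfl : g = 4 := le_antisymm hg4 hg
  have hJ := hasMinimalResolution_span_range_mul (a := ![z, w]) (x := x)
    (by intro i; fin_cases i <;> assumption) (hpair 2 3 (by simp)) hx hx0
  have hIeq : I = Ideal.span (Set.range fun i => ![z, w] i * x) ⊔ Ideal.span {y * z} ⊔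
      Ideal.span {y * w} := by
    rw [h, ← Ideal.span_union, ← Ideal.span_union]
    congr 1
    ext; simp [Fin.exists_fin_two, mul_comm, eq_comm]; grind
  rw [hIeq]
  refine hasBettiTable_of_two_cones hJ hLx
    (hasMinimalResolution_span_pair hx hz (hpair 0 2 (by simp))) (hy.mul hz) (hy.mul hw) ?_ ?_
  · intro f
    constructor
    · intro hf
      obtain ⟨c, rfl⟩ := Ideal.mem_span_singleton'.1 hf
      rw [show c * x * (y * z) = c * y * (![z, w] 0 * x) by simp; ring]
      exact hmul _ 0 _
    · intro hf
      obtain ⟨p, -, hp⟩ := mul_mem_span_range_mul_iff.1 hf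
      have h1 : f * y * z ∈ Ideal.span {x} :=
        Ideal.mem_span_singleton'.2 ⟨p, by rw [hp]; ring⟩
      exact (px.mem_or_mem ((px.mem_or_mem h1).resolve_right zx)).resolve_right yx
  · intro f
    constructor
    · intro hf
      obtain ⟨c, d, rfl⟩ := Ideal.mem_span_pair.1 hf
      rw [show (c * x + d * z) * (y * w) = c * y * (![z, w] 1 * x) + d * w * (y * z) by
        simp; ring]
      exact Submodule.add_mem_sup (hmul _ 1 _)
        (Ideal.mul_mem_left _ _ (Ideal.mem_span_singleton_self _))
    · intro hf
      have hle : Ideal.span (Set.range fun i => ![z, w] i * x) ⊔ Ideal.span {y * z} ≤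
          Ideal.span {x, z} := by
        refine sup_le (Ideal.span_le.2 ?_) (Ideal.span_le.2 ?_)
        · rintro _ ⟨i, rfl⟩
          exact Ideal.mul_mem_left _ _ (Ideal.subset_span (by simp))
        · rintro _ rfl
          exact Ideal.mul_mem_left _ _ (Ideal.subset_span (by simp))
      have h1 : f * y * w ∈ Ideal.span {x, z} := by
        rw [mul_assoc]
        exact hle hf
      exact (pxz.mem_or_mem ((pxz.mem_or_mem h1).resolve_right wxz)).resolve_right yxz
/-- Here `J = (x², x y)`, and `y²` and `x z + y w` are added with colon ideals `(x)` and `(x, y)`.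
As `I` is generated by four quadrics, `g ≤ 4`. -/
lemma hasBettiTable_sq_sup {x y z w : MvPolynomial (Fin n) k} (hx : x.IsHomogeneous 1)
    (hy : y.IsHomogeneous 1) (hz : z.IsHomogeneous 1) (hw : w.IsHomogeneous 1)
    (hli : LinearIndependent k ![x, y, z, w])
    (hI : IsMinimallyGeneratedByQuadrics I g) (hg : 4 ≤ g)
    (h : I = Ideal.span {x, y} ^ 2 ⊔ Ideal.span {x * z + y * w}) :
    HasBettiTable I (linearTable g) := by
  have hhom : ∀ i, (![x, y, z, w] i).IsHomogeneous 1 := by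
    intro i; fin_cases i <;> assumption
  have hprime : ∀ s : Set (Fin 4), (Ideal.span (![x, y, z, w] '' s)).IsPrime := fun s =>
    isPrime_span_of_isHomogeneous_one (by rintro _ ⟨i, -, rfl⟩; exact hhom i)
  have hnot : ∀ (i : Fin 4) (s : Set (Fin 4)), i ∉ s →
      ![x, y, z, w] i ∉ Ideal.span (![x, y, z, w] '' s) :=
    fun i s hi => notMem_ideal_span_image hhom hli hi
  have hpair : ∀ i j : Fin 4, i ≠ j →
      LinearIndependent k ![![x, y, z, w] i, ![x, y, z, w] j] := by
    intro i j hij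
    convert hli.comp ![i, j] (by intro a b; fin_cases a <;> fin_cases b <;> simp [hij, hij.symm])
      using 1
    funext a; fin_cases a <;> rfl
  have hx0 : x ≠ 0 := hli.ne_zero 0
  -- the prime ideals `(x)`, `(y)`, `(x, y)` and the linear forms outside
  have px : (Ideal.span {x}).IsPrime := by simpa using hprime {0}
  have py : (Ideal.span {y}).IsPrime := by simpa using hprime {1}
  have pxy : (Ideal.span {x, y}).IsPrime := by simpa [Set.image_pair] using hprime {0, 1}
  have yx : y ∉ Ideal.span {x} := by simpa using hnot 1 {0} (by simp)
  have xy : x ∉ Ideal.span {y} := by simpa using hnot 0 {1} (by simp)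
  have zxy : z ∉ Ideal.span {x, y} := by simpa [Set.image_pair] using hnot 2 {0, 1} (by simp)
  have hLx := hasMinimalResolution_span_singleton hx hx0
  -- membership in `x · (a₁, a₂)`
  have hmul : ∀ a : Fin 2 → MvPolynomial (Fin n) k, ∀ i f,
      f * (a i * x) ∈ Ideal.span (Set.range fun i => a i * x) := fun a i f =>
    Ideal.mul_mem_left _ _ (Ideal.subset_span ⟨i, rfl⟩)
  rw [sq, Ideal.span_pair_mul_span_pair] at h
  have hq : (x * z + y * w).IsHomogeneous 2 := (hx.mul hz).add (hy.mul hw)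
  have hg4 : g ≤ 4 := by
    refine hI.le_card (h := ![x * x, x * y, y * y, x * z + y * w]) ?_ ?_
    · intro i
      fin_cases i
      exacts [hx.mul hx, hx.mul hy, hy.mul hy, hq]
    · rw [h, ← Ideal.span_union]
      congr 1
      ext; simp [Matrix.range_cons, mul_comm y x]; grind
  obtain rfl : g = 4 := le_antisymm hg4 hg
  have hJ := hasMinimalResolution_span_range_mul (a := ![x, y]) (x := x)
    (by intro i; fin_cases i <;> assumption) (hpair 0 1 (by simp)) hx hx0
  have hIeq : I = Ideal.span (Set.range fun i => ![x, y] i * x) ⊔ Ideal.span {y * y} ⊔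
      Ideal.span {x * z + y * w} := by
    rw [h, ← Ideal.span_union, ← Ideal.span_union, ← Ideal.span_union]
    congr 1
    ext; simp [Fin.exists_fin_two, mul_comm y x, eq_comm]; grind
  rw [hIeq]
  refine hasBettiTable_of_two_cones hJ hLx
    (hasMinimalResolution_span_pair hx hy (hpair 0 1 (by simp))) (hy.mul hy) hq ?_ ?_
  · intro f
    constructor
    · intro hf
      obtain ⟨c, rfl⟩ := Ideal.mem_span_singleton'.1 hf
      rw [show c * x * (y * y) = c * y * (![x, y] 1 * x) by simp; ring]
      exact hmul _ 1 _
    · intro hf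
      obtain ⟨p, -, hp⟩ := mul_mem_span_range_mul_iff.1 hf
      have h1 : f * y * y ∈ Ideal.span {x} :=
        Ideal.mem_span_singleton'.2 ⟨p, by rw [hp]; ring⟩
      exact (px.mem_or_mem ((px.mem_or_mem h1).resolve_right yx)).resolve_right yx
  · intro f
    constructor
    · intro hf
      obtain ⟨c, d, rfl⟩ := Ideal.mem_span_pair.1 hf
      rw [show (c * x + d * y) * (x * z + y * w) = c * z * (![x, y] 0 * x) +
        (c * w + d * z) * (![x, y] 1 * x) + d * w * (y * y) by simp; ring]
      exact Submodule.add_mem_sup (add_mem (hmul _ 0 _) (hmul _ 1 _))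
        (Ideal.mul_mem_left _ _ (Ideal.mem_span_singleton_self _))
    · intro hf
      obtain ⟨p, hp, r, hr, hpr⟩ := Submodule.mem_sup.1 hf
      obtain ⟨p, hp', rfl⟩ := mul_mem_span_range_mul_iff.1 hp
      obtain ⟨c, rfl⟩ := Ideal.mem_span_singleton'.1 hr
      rw [Matrix.range_cons_cons_empty] at hp'
      -- comparing with `f (x z + y w)`, `y` divides `x (p - f z)` and hence `p - f z`
      have h1 : x * (p - f * z) ∈ Ideal.span {y} :=
        Ideal.mem_span_singleton'.2 ⟨f * w - c * y, by linear_combination -hpr⟩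
      have h2 : p - f * z ∈ Ideal.span {x, y} :=
        Ideal.span_mono (by simp) ((py.mem_or_mem h1).resolve_left xy)
      have h3 : f * z ∈ Ideal.span {x, y} := by
        rw [← sub_sub_cancel p (f * z)]
        exact sub_mem hp' h2
      exact (pxy.mem_or_mem h3).resolve_right zxy

lemma IsOfFormIa.hasBettiTable (h : IsOfFormIa I) (hI : IsMinimallyGeneratedByQuadrics I g)
    (hg : 4 ≤ g) : HasBettiTable I (linearTable g) := by
  obtain ⟨x, y, z, w, hx, hy, hz, hw, hli, h | h⟩ := h
  · exact hasBettiTable_inf hx hy hz hw hli hI hg h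
  · exact hasBettiTable_sq_sup hx hy hz hw hli hI hg h

/-- The two tables differ, so no ideal has both. -/
lemma HasBettiTable.not_twoRowTable (h : HasBettiTable I (linearTable g)) (hg : 4 ≤ g) :
    ¬ HasBettiTable I (twoRowTable g) := by
  intro h'
  obtain ⟨⟨F⟩, h⟩ := h
  have h1 := (h F 2 2).symm.trans (h'.2 F 2 2)
  simp [linearTable, twoRowTable] at h1
  omega

end Tables

end QuadricBetti

theorem mainTheorem6 {k : Type*} [Field k] [IsAlgClosed k] (n g : ℕ) (hg : 4 ≤ g)
    (I : Ideal (MvPolynomial (Fin n) k))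
    (hI : QuadricBetti.IsMinimallyGeneratedByQuadrics I g)
    (hform : QuadricBetti.IsOfFormIa I ∨ QuadricBetti.IsOfFormIb I g ∨
      QuadricBetti.IsOfFormIi I g) :
    (QuadricBetti.HasBettiTable I (QuadricBetti.linearTable g) ∨
      QuadricBetti.HasBettiTable I (QuadricBetti.twoRowTable g)) ∧
    (QuadricBetti.HasBettiTable I (QuadricBetti.linearTable g) ↔
      (QuadricBetti.IsOfFormIa I ∨ QuadricBetti.IsOfFormIb I g)) ∧
    (QuadricBetti.HasBettiTable I (QuadricBetti.twoRowTable g) ↔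
      QuadricBetti.IsOfFormIi I g) := by
  have hlin : QuadricBetti.IsOfFormIa I ∨ QuadricBetti.IsOfFormIb I g →
      QuadricBetti.HasBettiTable I (QuadricBetti.linearTable g) := by
    rintro (h | h)
    · exact h.hasBettiTable hI hg
    · exact h.hasBettiTable hI hg
  have htwo : QuadricBetti.IsOfFormIi I g →
      QuadricBetti.HasBettiTable I (QuadricBetti.twoRowTable g) := fun h => h.hasBettiTable hI hg
  have hne : QuadricBetti.HasBettiTable I (QuadricBetti.linearTable g) →
      ¬ QuadricBetti.HasBettiTable I (QuadricBetti.twoRowTable g) := fun h =>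
    h.not_twoRowTable hg
  tauto
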